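/- Let $u$ be the Hastings--McLeod solution of Painlev\'e II, i.e. the real solution on $\mathbb{R}$ of $u''=tu+2u^3$ with $u(t)\to 0$ as $t\to\infty$ and $u(t)\sim\sqrt{-t/2}$ as $t\to-\infty$. Consider the system $$q_2'=\tfrac23\alpha q_2+\frac{u'}{u}\,\frac{(1+q_2)(2-q_2)}{3},\qquad \alpha'=\alpha\Big(\tfrac23\alpha+\frac{u'}{u}\,\frac{2-q_2}{3}\Big)-\frac t6(1+q_2)-\frac{u^2}{3}(3+q_2).\qquad(*)$$ Say that a pair of real functions $(q_2,\alpha)$ has the asymptotics (A) at $-\infty$, with real coefficient sequences $(a_n)_{n\ge0}$, $(b_n)_{n\ge0}$, if, as $t\to-\infty$, $$q_2(t)\sim\sum_{n\ge0}a_n(-t)^{-\frac32-\frac{3n}2},\qquad \alpha(t)\sim\sum_{n\ge0}b_n(-t)^{\frac12-\frac{3n}2}$$ as asymptotic series to all orders, where $$(a_0,a_1,a_2,a_3)=\Big(\tfrac1{\sqrt2},\tfrac{21}8,\tfrac{1707}{64\sqrt2},\tfrac{49123}{256}\Big),\qquad (b_0,b_1,b_2,b_3)=\Big(\tfrac1{\sqrt2},-\tfrac18,-\tfrac{37}{64\sqrt2},-\tfrac{373}{256}\Big).$$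 Theorem. Suppose that a real solution $(q_{20},\alpha_0)$ of $(*)$ is nonsingular on $(-\infty,t_0]$ and has the asymptotics (A) with coefficients $(a_n),(b_n)$. Then every nearby solution is nonsingular on $(-\infty,t_0]$ and has the same asymptotics. Precisely: for every $t_1\le t_0$ there is $\delta>0$ such that for all real $x,y$ with $|x-q_{20}(t_1)|<\delta$ and $|y-\alpha_0(t_1)|<\delta$ the solution $(q_2,\alpha)$ of $(*)$ with $q_2(t_1)=x$, $\alpha(t_1)=y$ exists on all of $(-\infty,t_0]$, is unique (every solution with these values at $t_1$ on an interval $J$ with $t_1\in J\subseteq(-\infty,t_0]$ agrees with it on $J$), and has the asymptotics (A) with the same coefficients $(a_n),(b_n)$. Moreover it is exponentially close to $(q_{20},\alpha_0)$: as $t\to-\infty$, $$q_2(t)-q_{20}(t)=O\Big((-t)^{\frac14}e^{-\frac{2\sqrt2}9(-t)^{3/2}}\Big),\qquad \alpha(t)-\alpha_0(t)=O\Big((-t)^{-\frac34}e^{-\frac{2\sqrt2}9(-t)^{3/2}}\Big).$$ -/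

import Mathlib

open Filter Topology Asymptotics

/-- The Hastings-McLeod solution `u` of Painlevé II: the real solution on the whole line of
`u'' = t u + 2 u ^ 3` with `u(t) → 0` as `t → ∞` and `u(t) ~ √(-t / 2)` as `t → -∞`. -/
structure IsHastingsMcLeod (u : ℝ → ℝ) : Prop where
  differentiable : Differentiable ℝ u
  painleve : ∀ t : ℝ, HasDerivAt (deriv u) (t * u t + 2 * u t ^ 3) t
  tendsto_atTop : Tendsto u atTop (𝓝 0)
  isEquivalent_atBot : u ~[atBot] fun t : ℝ => √(-t / 2)

/-- `(q, α)` is a (finite, real, differentiable) solution of the `q₂`-`α` system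
`q' = (2/3) α q + (u'/u) (1 + q) (2 - q) / 3`,
`α' = α ((2/3) α + (u'/u) (2 - q) / 3) - (t/6) (1 + q) - (u²/3) (3 + q)`
at every point of `S`; derivatives are taken within `S`, hence one-sided at the ends of an
interval. -/
structure IsQAlphaSolutionOn (u q α : ℝ → ℝ) (S : Set ℝ) : Prop where
  deriv_q : ∀ t ∈ S, HasDerivWithinAt q
    (2 / 3 * α t * q t + deriv u t / u t * ((1 + q t) * (2 - q t) / 3)) S t
  deriv_α : ∀ t ∈ S, HasDerivWithinAt α
    (α t * (2 / 3 * α t + deriv u t / u t * ((2 - q t) / 3)) - t / 6 * (1 + q t)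
      - u t ^ 2 / 3 * (3 + q t)) S t

/-- The asymptotic expansion `f(t) ~ ∑ n, c n * (-t) ^ (ρ - 3 n / 2)` as `t → -∞`, to all orders,
in the sense of Poincaré: every partial sum is accurate up to the size of the next term. -/
def HasExpansionAtBot (f : ℝ → ℝ) (ρ : ℝ) (c : ℕ → ℝ) : Prop :=
  ∀ N : ℕ, (fun t : ℝ => f t - ∑ n ∈ Finset.range N, c n * (-t) ^ (ρ - 3 * (n : ℝ) / 2))
    =O[atBot] fun t : ℝ => (-t) ^ (ρ - 3 * (N : ℝ) / 2)

/-- The asymptotics at `t = -∞`, with full coefficient sequences `a` and `b`: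
`q(t) = (1/√2) (-t)^(-3/2) + (21/8) (-t)^(-3) + (1707/(64√2)) (-t)^(-9/2)
  + (49123/256) (-t)^(-6) + ∑ n ≥ 4, a n (-t)^(-3/2 - 3n/2)`,
`α(t) = (1/√2) (-t)^(1/2) - (1/8) (-t)^(-1) - (37/(64√2)) (-t)^(-5/2)
  - (373/256) (-t)^(-4) + ∑ n ≥ 4, b n (-t)^(1/2 - 3n/2)`. -/
structure HasQAlphaAsymptotics (a b : ℕ → ℝ) (q α : ℝ → ℝ) : Prop where
  a_zero : a 0 = 1 / √2
  a_one : a 1 = 21 / 8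
  a_two : a 2 = 1707 / (64 * √2)
  a_three : a 3 = 49123 / 256
  b_zero : b 0 = 1 / √2
  b_one : b 1 = -(1 / 8)
  b_two : b 2 = -(37 / (64 * √2))
  b_three : b 3 = -(373 / 256)
  expansion_q : HasExpansionAtBot q (-(3 / 2)) a
  expansion_α : HasExpansionAtBot α (1 / 2) b

/-! Reverse time, `s = -t`. Along the Painlevé II flow the Riccati functions `u' ± (u² + t/2)` solve
linear first-order equations, one stable and one unstable as `s → ∞`, and comparison with powers
of `s` gives `u'/u = -1/(2s) + O(s⁻²)` and `u² = s/2 + O(s⁻²)`. Their strict monotonicity, after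
multiplication by an integrating factor, also shows that `u` has no zeros, so the system is regular.

The displacement `z` of two solutions satisfies a quadratic system. With `q₂ = O(s⁻¹)` and
`α = √(s/2) - 1/(8s) + O(s⁻²)`, its linear part becomes diagonal to leading order in the
coordinates `Q = z.1` and `R = s * z.2 + Q/4`, with rates `-(√2/3)√s` (slow) and `-(2√2/3)√s`
(fast). The energy `Q² + R²` of a small displacement therefore decays like
`√s * exp (-(4√2/9) s^(3/2))`: the factor `√s` comes from the correction `1/(4s)` to the slow rate,
and the weight `s` in `R` explains why `α` is closer than `q₂`. Global existence is obtained by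
truncating the vector field, since small displacements never see the truncation; on the compact
part of the half-line smallness is Gronwall's inequality. Exponentially close solutions share
their asymptotic series. -/

theorem le_of_hasDerivAt_lt_of_eq {f f' g g' : ℝ → ℝ} {S : ℝ}
    (hf : ∀ s, S ≤ s → HasDerivAt f (f' s) s) (hg : ∀ s, S ≤ s → HasDerivAt g (g' s) s)
    (hS : f S ≤ g S) (hlt : ∀ s, S ≤ s → f s = g s → f' s < g' s) {s : ℝ} (hs : S ≤ s) :
    f s ≤ g s :=
  image_le_of_deriv_right_lt_deriv_boundary'
    (fun x hx => (hf x hx.1).continuousAt.continuousWithinAt)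
    (fun x hx => (hf x hx.1).hasDerivWithinAt) hS
    (fun x hx => (hg x hx.1).continuousAt.continuousWithinAt)
    (fun x hx => (hg x hx.1).hasDerivWithinAt) (fun x hx => hlt x hx.1) ⟨hs, le_rfl⟩

theorem hasDerivAt_rpow_three_halves {s : ℝ} (hs : 0 < s) :
    HasDerivAt (fun s : ℝ => s ^ (3 / 2 : ℝ)) (3 / 2 * √s) s := by
  refine (Real.hasDerivAt_rpow_const (p := 3 / 2) (Or.inl hs.ne')).congr_deriv ?_
  rw [Real.sqrt_eq_rpow]
  norm_num

theorem isLittleO_exp_neg_mul_rpow_three_halves {c : ℝ} (hc : 0 < c) (b : ℝ) :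
    (fun s : ℝ => Real.exp (-c * s ^ (3 / 2 : ℝ))) =o[atTop] fun s : ℝ => s ^ b := by
  have h := (isLittleO_exp_neg_mul_rpow_atTop hc (b * (2 / 3))).comp_tendsto
    (tendsto_rpow_atTop (y := 3 / 2) (by norm_num))
  refine h.congr' EventuallyEq.rfl ?_
  filter_upwards [eventually_ge_atTop 0] with s hs
  rw [Function.comp, ← Real.rpow_mul hs]
  congr 1
  ring

theorem rpow_isLittleO_exp_mul_rpow_three_halves {c : ℝ} (hc : 0 < c) (b : ℝ) :
    (fun s : ℝ => s ^ b) =o[atTop] fun s : ℝ => Real.exp (c * s ^ (3 / 2 : ℝ)) := by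
  refine ((isLittleO_exp_neg_mul_rpow_three_halves hc (-b)).inv_rev ?_).congr' ?_ ?_
  · exact Eventually.of_forall fun s h => absurd h (Real.exp_ne_zero _)
  · filter_upwards [eventually_ge_atTop 0] with s hs
    rw [Real.rpow_neg hs, inv_inv]
  · exact Eventually.of_forall fun s => by simp only [neg_mul, Real.exp_neg, inv_inv]

theorem abs_mul_rpow_sub_one_le {b s : ℝ} (hs : 1 ≤ s) (hb : 2 * |b| ≤ s) :
    |b * s ^ (b - 1)| ≤ √s * s ^ b / 2 := by
  have hpos : 0 < s := by linarith
  have hσ : 1 ≤ √s := Real.one_le_sqrt.2 hs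
  have hw : 0 < s ^ b := Real.rpow_pos_of_pos hpos b
  calc |b * s ^ (b - 1)| = |b| / s * s ^ b := by
        rw [Real.rpow_sub_one hpos.ne', abs_mul, abs_of_pos (by positivity : 0 < s ^ b / s)]
        ring
    _ ≤ 1 / 2 * s ^ b := by
        refine mul_le_mul_of_nonneg_right ?_ hw.le
        rw [div_le_iff₀ hpos]
        linarith
    _ ≤ √s * s ^ b / 2 := by nlinarith

theorem sqrt_mul_rpow {s : ℝ} (hs : 0 < s) (b : ℝ) : √s * s ^ b = s ^ (b + 1 / 2) := by
  rw [Real.sqrt_eq_rpow, ← Real.rpow_add hs, add_comm]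

section LinearComparison

variable {y p g : ℝ → ℝ} {b C K S : ℝ}

theorem le_mul_rpow_of_stable (hS : 1 ≤ S) (hSb : 2 * |b| ≤ S) (hK : 2 * K < C)
    (hy : ∀ s, S ≤ s → HasDerivAt y (-(p s * y s) + g s) s) (hp : ∀ s, S ≤ s → √s ≤ p s)
    (hg : ∀ s, S ≤ s → |g s| ≤ K * (√s * s ^ b)) (hyS : y S ≤ C * S ^ b) {s : ℝ} (hs : S ≤ s) :
    y s ≤ C * s ^ b := by
  have hpos : ∀ {s}, S ≤ s → 0 < s := fun hs => by linarith
  refine le_of_hasDerivAt_lt_of_eq hy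
    (fun s hs => (Real.hasDerivAt_rpow_const (Or.inl (hpos hs).ne')).const_mul C) hyS ?_ hs
  intro s hs hyC
  have hw : 0 < √s * s ^ b :=
    mul_pos (Real.sqrt_pos.2 (hpos hs)) (Real.rpow_pos_of_pos (hpos hs) b)
  have hC : 0 < C := by nlinarith [(abs_nonneg _).trans (hg s hs)]
  have hdamp : C * (√s * s ^ b) ≤ p s * y s := by
    rw [hyC, mul_left_comm]
    exact mul_le_mul_of_nonneg_right (hp s hs)
      (mul_nonneg hC.le (Real.rpow_nonneg (hpos hs).le b))
  have hbarrier := mul_le_mul_of_nonneg_left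
    (abs_le.1 (abs_mul_rpow_sub_one_le (hS.trans hs) (hSb.trans hs))).1 hC.le
  nlinarith [le_of_abs_le (hg s hs)]

theorem le_mul_rpow_of_unstable (hS : 1 ≤ S) (hSb : 2 * |b| ≤ S) (hK : 2 * K < C)
    (hy : ∀ s, S ≤ s → HasDerivAt y (p s * y s + g s) s) (hp : ∀ s, S ≤ s → √s ≤ p s)
    (hg : ∀ s, S ≤ s → |g s| ≤ K * (√s * s ^ b))
    (hgrowth : y =o[atTop] fun s : ℝ => Real.exp (2 / 3 * s ^ (3 / 2 : ℝ))) {s : ℝ}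
    (hs : S ≤ s) : y s ≤ C * s ^ b := by
  set E : ℝ → ℝ := fun s => Real.exp (2 / 3 * s ^ (3 / 2 : ℝ)) with hE
  have hpos : ∀ {s}, S ≤ s → 0 < s := fun hs => by linarith
  have hw : ∀ {s}, S ≤ s → 0 < s ^ b := fun hs => Real.rpow_pos_of_pos (hpos hs) b
  have hσ : ∀ {s}, S ≤ s → 0 < √s := fun hs => Real.sqrt_pos.2 (hpos hs)
  have hC : 0 < C := by nlinarith [(abs_nonneg _).trans (hg s hs), mul_pos (hσ hs) (hw hs)]
  have hdE : ∀ s, S ≤ s → HasDerivAt E (√s * E s) s := fun s hs =>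
    (((hasDerivAt_rpow_three_halves (hpos hs)).const_mul (2 / 3)).exp).congr_deriv (by ring)
  -- Once above the barrier `C s ^ b + η E s`, the solution would stay above it.
  suffices h : ∀ η, 0 < η → y s ≤ C * s ^ b + η * E s from
    le_of_forall_pos_le_add fun ε hε => by
      simpa [div_mul_cancel₀ _ (Real.exp_ne_zero _), hE] using
        h (ε / E s) (div_pos hε (Real.exp_pos _))
  intro η hη
  by_contra! habove
  have hstay : ∀ x, s ≤ x → C * x ^ b + η * E x ≤ y x := fun x hx =>
    le_of_hasDerivAt_lt_of_eq
      (fun x hx => ((Real.hasDerivAt_rpow_const (Or.inl (hpos (hs.trans hx)).ne')).const_mul C).add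
        ((hdE x (hs.trans hx)).const_mul η))
      (fun x hx => hy x (hs.trans hx)) habove.le (by
        intro x hx hyx
        have hSx := hs.trans hx
        have hbarrier := mul_le_mul_of_nonneg_left
          (abs_le.1 (abs_mul_rpow_sub_one_le (hS.trans hSx) (hSb.trans hSx))).2 hC.le
        have hgrow : √x * (C * x ^ b + η * E x) ≤ p x * y x := by
          rw [← hyx]
          have := mul_pos hC (hw hSx)
          exact mul_le_mul_of_nonneg_right (hp x hSx) (by positivity)
        nlinarith [neg_le_of_abs_le (hg x hSx), mul_pos (hσ hSx) (hw hSx)]) hx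
  obtain ⟨x, hbound, hx⟩ := ((hgrowth.bound hη).and (eventually_ge_atTop s)).exists
  rw [Real.norm_eq_abs, Real.norm_of_nonneg (Real.exp_pos _).le] at hbound
  linarith [hstay x hx, le_of_abs_le hbound, mul_pos hC (hw (hs.trans hx))]

theorem exists_eventually_abs_le_mul_sqrt_mul_rpow {a : ℝ}
    (hg : g =O[atTop] fun s : ℝ => s ^ (a + 1 / 2)) :
    ∃ K, ∀ᶠ s in atTop, 1 ≤ s ∧ 2 * |a| ≤ s ∧ |g s| ≤ K * (√s * s ^ a) := by
  obtain ⟨K, hK⟩ := hg.bound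
  refine ⟨K, ?_⟩
  filter_upwards [hK, eventually_ge_atTop 1, eventually_ge_atTop (2 * |a|)] with s hs hs1 hs2
  have hpos : 0 < s := by linarith
  rw [Real.norm_of_nonneg (Real.rpow_nonneg hpos.le _), ← sqrt_mul_rpow hpos] at hs
  exact ⟨hs1, hs2, hs⟩

theorem isBigO_rpow_of_stable {a : ℝ} (hy : ∀ᶠ s in atTop, HasDerivAt y (-(p s * y s) + g s) s)
    (hp : ∀ᶠ s in atTop, √s ≤ p s) (hg : g =O[atTop] fun s : ℝ => s ^ (a + 1 / 2)) :
    y =O[atTop] fun s : ℝ => s ^ a := by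
  obtain ⟨K, hK⟩ := exists_eventually_abs_le_mul_sqrt_mul_rpow hg
  obtain ⟨S, hS⟩ := ((hy.and hp).and hK).exists_forall_of_atTop
  obtain ⟨hS1, hSa, -⟩ := (hS S le_rfl).2
  set C := max (|y S| / S ^ a) (2 * K + 1)
  have hKC : 2 * K < C := (lt_add_one _).trans_le (le_max_right _ _)
  have hyS : |y S| ≤ C * S ^ a :=
    (div_le_iff₀ (Real.rpow_pos_of_pos (by linarith) _)).1 (le_max_left _ _)
  refine IsBigO.of_bound C ?_
  filter_upwards [eventually_ge_atTop S] with s hs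
  rw [Real.norm_of_nonneg (Real.rpow_nonneg (by linarith : 0 ≤ s) _)]
  refine abs_le'.2 ⟨?_, ?_⟩
  · exact le_mul_rpow_of_stable hS1 hSa hKC (fun s hs => (hS s hs).1.1)
      (fun s hs => (hS s hs).1.2) (fun s hs => (hS s hs).2.2.2) (abs_le'.1 hyS).1 hs
  · exact le_mul_rpow_of_stable (y := fun s => -y s) (g := fun s => -g s) hS1 hSa hKC
      (fun s hs => (hS s hs).1.1.neg.congr_deriv (by ring)) (fun s hs => (hS s hs).1.2)
      (fun s hs => (abs_neg _).trans_le (hS s hs).2.2.2) (abs_le'.1 hyS).2 hs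

theorem isBigO_rpow_of_unstable {a : ℝ} (hy : ∀ᶠ s in atTop, HasDerivAt y (p s * y s + g s) s)
    (hp : ∀ᶠ s in atTop, √s ≤ p s) (hg : g =O[atTop] fun s : ℝ => s ^ (a + 1 / 2))
    (hgrowth : y =o[atTop] fun s : ℝ => Real.exp (2 / 3 * s ^ (3 / 2 : ℝ))) :
    y =O[atTop] fun s : ℝ => s ^ a := by
  obtain ⟨K, hK⟩ := exists_eventually_abs_le_mul_sqrt_mul_rpow hg
  obtain ⟨S, hS⟩ := ((hy.and hp).and hK).exists_forall_of_atTop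
  obtain ⟨hS1, hSa, -⟩ := (hS S le_rfl).2
  refine IsBigO.of_bound (2 * K + 1) ?_
  filter_upwards [eventually_ge_atTop S] with s hs
  rw [Real.norm_of_nonneg (Real.rpow_nonneg (by linarith : 0 ≤ s) _)]
  refine abs_le'.2 ⟨?_, ?_⟩
  · exact le_mul_rpow_of_unstable hS1 hSa (lt_add_one _) (fun s hs => (hS s hs).1.1)
      (fun s hs => (hS s hs).1.2) (fun s hs => (hS s hs).2.2.2) hgrowth hs
  · exact le_mul_rpow_of_unstable (y := fun s => -y s) (g := fun s => -g s) hS1 hSa (lt_add_one _)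
      (fun s hs => (hS s hs).1.1.neg.congr_deriv (by ring)) (fun s hs => (hS s hs).1.2)
      (fun s hs => (abs_neg _).trans_le (hS s hs).2.2.2) hgrowth.neg_left hs

end LinearComparison

section LinearGrowthAndGlobalExistence

variable {E : Type*} [NormedAddCommGroup E] [NormedSpace ℝ E]

theorem norm_le_norm_mul_exp_of_le {f f' : ℝ → E} {K a b : ℝ} (hab : a ≤ b)
    (hf : ∀ t ∈ Set.Icc a b, HasDerivWithinAt f (f' t) (Set.Icc a b) t)
    (hK : ∀ t ∈ Set.Icc a b, ‖f' t‖ ≤ K * ‖f t‖) :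
    ‖f b‖ ≤ ‖f a‖ * Real.exp (K * (b - a)) := by
  rw [← gronwallBound_ε0]
  refine norm_le_gronwallBound_of_norm_deriv_right_le (fun t ht => (hf t ht).continuousWithinAt)
    (fun t ht => (hf t ⟨ht.1, ht.2.le⟩).mono_of_mem_nhdsWithin ?_) le_rfl
    (fun t ht => ?_) b ⟨hab, le_rfl⟩
  · exact mem_of_superset (Icc_mem_nhdsGE ht.2) (Set.Icc_subset_Icc_left ht.1)
  · rw [add_zero]
    exact hK t ⟨ht.1, ht.2.le⟩

theorem norm_le_norm_mul_exp {f f' : ℝ → E} {K a b : ℝ}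
    (hf : ∀ t ∈ Set.uIcc a b, HasDerivWithinAt f (f' t) (Set.uIcc a b) t)
    (hK : ∀ t ∈ Set.uIcc a b, ‖f' t‖ ≤ K * ‖f t‖) :
    ‖f b‖ ≤ ‖f a‖ * Real.exp (K * |b - a|) := by
  rcases le_total a b with hab | hba
  · rw [Set.uIcc_of_le hab] at hf hK
    rw [abs_of_nonneg (sub_nonneg.2 hab)]
    exact norm_le_norm_mul_exp_of_le hab hf hK
  · rw [Set.uIcc_of_ge hba] at hf hK
    have hmem : ∀ t ∈ Set.Icc (-a) (-b), -t ∈ Set.Icc b a := fun t ht =>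
      ⟨by linarith [ht.2], by linarith [ht.1]⟩
    have hreflect := norm_le_norm_mul_exp_of_le (f := fun t => f (-t)) (f' := fun t => -f' (-t))
      (neg_le_neg hba) (fun t ht => by
        simpa [Function.comp_def] using
          (hf (-t) (hmem t ht)).scomp t (hasDerivAt_neg t).hasDerivWithinAt hmem)
      (fun t ht => by simpa only [norm_neg] using hK (-t) (hmem t ht))
    simpa only [neg_neg, abs_of_nonpos (sub_nonpos.2 hba), neg_sub, neg_sub_neg] using hreflect

theorem eqOn_Icc_of_isIntegralCurveOn {f : ℝ → E → E} {T t₀ t₁ : ℝ} {K : NNReal}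
    {z w : ℝ → E} (hz : IsIntegralCurveOn z f (Set.Icc T t₀))
    (hw : IsIntegralCurveOn w f (Set.Icc T t₀))
    (hK : ∀ t ∈ Set.Icc T t₀, LipschitzWith K (f t)) (ht₁ : t₁ ∈ Set.Icc T t₀)
    (h : z t₁ = w t₁) : Set.EqOn z w (Set.Icc T t₀) := by
  intro t ht
  have hsub : Set.uIcc t₁ t ⊆ Set.Icc T t₀ := Set.ordConnected_Icc.uIcc_subset ht₁ ht
  have hgronwall := norm_le_norm_mul_exp (f := z - w) (K := K) (a := t₁) (b := t)
    (fun x hx => ((hz x (hsub hx)).sub (hw x (hsub hx))).mono hsub)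
    (fun x hx => by
      simpa only [dist_eq_norm, Pi.sub_apply] using (hK x (hsub hx)).dist_le_mul (z x) (w x))
  rw [Pi.sub_apply, Pi.sub_apply, h, sub_self, norm_zero, zero_mul] at hgronwall
  exact sub_eq_zero.1 (norm_le_zero_iff.1 hgronwall)

theorem exists_isIntegralCurveOn_Icc [CompleteSpace E] {f : ℝ → E → E} {T t₀ t₁ : ℝ}
    {K L : NNReal} (ht₁ : t₁ ∈ Set.Icc T t₀)
    (hcont : ∀ x, ContinuousOn (fun t => f t x) (Set.Icc T t₀))
    (hK : ∀ t ∈ Set.Icc T t₀, LipschitzWith K (f t))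
    (hL : ∀ t ∈ Set.Icc T t₀, ∀ x, ‖f t x‖ ≤ L) (z₁ : E) :
    ∃ z : ℝ → E, z t₁ = z₁ ∧ IsIntegralCurveOn z f (Set.Icc T t₀) := by
  have hm : 0 ≤ max (t₀ - t₁) (t₁ - T) := le_max_of_le_left (by linarith [ht₁.2])
  have hPL : IsPicardLindelof f (⟨t₁, ht₁⟩ : Set.Icc T t₀) z₁
      (L * (max (t₀ - t₁) (t₁ - T)).toNNReal) 0 L K :=
    { lipschitzOnWith := fun t ht => (hK t ht).lipschitzOnWith
      continuousOn := fun x _ => hcont x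
      norm_le := fun t ht x _ => hL t ht x
      mul_max_le := by rw [NNReal.coe_mul, Real.coe_toNNReal _ hm, NNReal.coe_zero, sub_zero] }
  exact hPL.exists_eq_forall_mem_Icc_hasDerivWithinAt (by simp)

theorem exists_isIntegralCurveOn_Iic [CompleteSpace E] {f : ℝ → E → E} {t₀ t₁ : ℝ}
    (ht₁ : t₁ ≤ t₀) (hcont : ∀ x, ContinuousOn (fun t => f t x) (Set.Iic t₀))
    (hb : ∀ T, ∃ K L : NNReal, ∀ t ∈ Set.Icc T t₀, LipschitzWith K (f t) ∧ ∀ x, ‖f t x‖ ≤ L)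
    (z₁ : E) :
    ∃ z : ℝ → E, z t₁ = z₁ ∧ IsIntegralCurveOn z f (Set.Iic t₀) := by
  have hmem : ∀ n : ℕ, t₁ ∈ Set.Icc (t₁ - n) t₀ := fun n => ⟨by simp, ht₁⟩
  have hex : ∀ n : ℕ, ∃ z : ℝ → E, z t₁ = z₁ ∧ IsIntegralCurveOn z f (Set.Icc (t₁ - n) t₀) :=
    fun n => by
      obtain ⟨K, L, h⟩ := hb (t₁ - n)
      exact exists_isIntegralCurveOn_Icc (hmem n)
        (fun x => (hcont x).mono Set.Icc_subset_Iic_self)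
        (fun t ht => (h t ht).1) (fun t ht => (h t ht).2) z₁
  choose z hz₁ hz using hex
  have hagree : ∀ m n : ℕ, m ≤ n → Set.EqOn (z m) (z n) (Set.Icc (t₁ - m) t₀) := by
    intro m n hmn
    obtain ⟨K, L, h⟩ := hb (t₁ - m)
    exact eqOn_Icc_of_isIntegralCurveOn (hz m)
      ((hz n).mono (Set.Icc_subset_Icc_left (by gcongr))) (fun t ht => (h t ht).1) (hmem m)
      ((hz₁ m).trans (hz₁ n).symm)
  set w : ℝ → E := fun t => z ⌈t₁ - t⌉₊ t
  have hwz : ∀ n : ℕ, Set.EqOn w (z n) (Set.Icc (t₁ - n) t₀) := fun n t ht =>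
    hagree _ n (Nat.ceil_le.2 (by linarith [ht.1])) ⟨by linarith [Nat.le_ceil (t₁ - t)], ht.2⟩
  refine ⟨w, (hwz 0 (hmem 0)).trans (hz₁ 0), fun t ht => ?_⟩
  obtain ⟨n, hn⟩ := exists_nat_gt (t₁ - t)
  have htn : t ∈ Set.Icc (t₁ - n) t₀ := ⟨by linarith, ht⟩
  have hnhds : Set.Icc (t₁ - n) t₀ ∈ 𝓝[Set.Iic t₀] t := by
    rw [← Set.Ici_inter_Iic, Set.inter_comm]
    exact inter_mem_nhdsWithin _ (Ici_mem_nhds (by linarith))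
  have hwt := ((hz n t htn).congr (hwz n) (hwz n htn)).mono_of_mem_nhdsWithin hnhds
  rwa [← hwz n htn] at hwt

end LinearGrowthAndGlobalExistence

theorem isBigO_rpow_rpow_of_le {a b : ℝ} (h : a ≤ b) :
    (fun s : ℝ => s ^ a) =O[atTop] fun s : ℝ => s ^ b := by
  refine IsBigO.of_bound 1 ?_
  filter_upwards [eventually_ge_atTop 1] with s hs
  rw [one_mul, Real.norm_of_nonneg (by positivity), Real.norm_of_nonneg (by positivity)]
  exact Real.rpow_le_rpow_of_exponent_le hs h

theorem isBigO_rpow_mul {f g : ℝ → ℝ} {a b c : ℝ} (hf : f =O[atTop] fun s : ℝ => s ^ a)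
    (hg : g =O[atTop] fun s : ℝ => s ^ b) (hc : a + b ≤ c) :
    (fun s => f s * g s) =O[atTop] fun s : ℝ => s ^ c := by
  refine (hf.mul hg).trans (IsBigO.trans ?_ (isBigO_rpow_rpow_of_le hc))
  refine EventuallyEq.isBigO ?_
  filter_upwards [eventually_gt_atTop 0] with s hs
  rw [Real.rpow_add hs]

theorem eventually_abs_le_of_isBigO_rpow_neg {f : ℝ → ℝ} {a ε : ℝ} (ha : 0 < a) (hε : 0 < ε)
    (hf : f =O[atTop] fun s : ℝ => s ^ (-a)) : ∀ᶠ s in atTop, |f s| < ε :=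
  (hf.trans_tendsto (tendsto_rpow_neg_atTop ha)).abs.eventually_lt_const (by rwa [abs_zero])

/-- The Riccati function `u' + u² + t / 2` of a function `u`. On solutions of Painlevé II it
satisfies the linear equation `A' = 2 u A + 1 / 2`. -/
noncomputable def riccatiAdd (u : ℝ → ℝ) (t : ℝ) : ℝ := deriv u t + u t ^ 2 + t / 2

/-- The Riccati function `u' - u² - t / 2` of a function `u`. On solutions of Painlevé II it
satisfies the linear equation `B' = -2 u B - 1 / 2`. -/
noncomputable def riccatiSub (u : ℝ → ℝ) (t : ℝ) : ℝ := deriv u t - u t ^ 2 - t / 2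

theorem riccatiSub_eq (u : ℝ → ℝ) (t : ℝ) :
    riccatiSub u t = riccatiAdd u t - 2 * u t ^ 2 - t := by
  simp only [riccatiAdd, riccatiSub]
  ring

namespace IsHastingsMcLeod

variable {u : ℝ → ℝ} (hu : IsHastingsMcLeod u)

include hu

theorem hasDerivAt (t : ℝ) : HasDerivAt u (deriv u t) t := (hu.differentiable t).hasDerivAt

theorem hasDerivAt_riccatiAdd (t : ℝ) :
    HasDerivAt (riccatiAdd u) (2 * u t * riccatiAdd u t + 1 / 2) t := by
  refine (((hu.painleve t).add ((hu.hasDerivAt t).pow 2)).add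
    ((hasDerivAt_id t).div_const 2)).congr_deriv ?_
  simp only [riccatiAdd]
  push_cast
  ring

theorem hasDerivAt_riccatiSub (t : ℝ) :
    HasDerivAt (riccatiSub u) (-(2 * u t * riccatiSub u t) - 1 / 2) t := by
  refine (((hu.painleve t).sub ((hu.hasDerivAt t).pow 2)).sub
    ((hasDerivAt_id t).div_const 2)).congr_deriv ?_
  simp only [riccatiSub]
  push_cast
  ring

theorem isEquivalent_comp_neg : (fun s => u (-s)) ~[atTop] fun s => √(s / 2) := by
  simpa [Function.comp_def] using hu.isEquivalent_atBot.comp_tendsto tendsto_neg_atTop_atBot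

theorem eventually_sqrt_le : ∀ᶠ s in atTop, √s ≤ 2 * u (-s) := by
  filter_upwards [hu.isEquivalent_comp_neg.isLittleO.bound (by norm_num : (0 : ℝ) < 1 / 4),
    eventually_gt_atTop 0] with s hs hpos
  rw [Pi.sub_apply, Real.norm_eq_abs, Real.norm_of_nonneg (Real.sqrt_nonneg _)] at hs
  have hle : √s ≤ 3 / 2 * √(s / 2) := by
    rw [Real.sqrt_le_left (by positivity), mul_pow, Real.sq_sqrt (by positivity)]
    linarith
  linarith [(abs_le.1 hs).1]

theorem isBigO_rpow_half : (fun s => u (-s)) =O[atTop] fun s : ℝ => s ^ (1 / 2 : ℝ) := by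
  refine hu.isEquivalent_comp_neg.isBigO.trans (IsBigO.of_bound 1 ?_)
  filter_upwards [eventually_ge_atTop 0] with s hs
  rw [one_mul, ← Real.sqrt_eq_rpow, Real.norm_of_nonneg (Real.sqrt_nonneg _),
    Real.norm_of_nonneg (Real.sqrt_nonneg _)]
  exact Real.sqrt_le_sqrt (by linarith)

theorem isBigO_inv : (fun s => (u (-s))⁻¹) =O[atTop] fun s : ℝ => s ^ (-(1 / 2) : ℝ) := by
  refine IsBigO.of_bound 2 ?_
  filter_upwards [hu.eventually_sqrt_le, eventually_gt_atTop 0] with s hs hpos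
  have hσ := Real.sqrt_pos.2 hpos
  have hu_pos : 0 < u (-s) := by linarith
  rw [Real.rpow_neg hpos.le, ← Real.sqrt_eq_rpow, norm_inv, norm_inv,
    Real.norm_of_nonneg hu_pos.le, Real.norm_of_nonneg hσ.le, ← div_eq_mul_inv,
    inv_le_comm₀ hu_pos (by positivity), inv_div]
  linarith

theorem isBigO_riccatiAdd :
    (fun s => riccatiAdd u (-s)) =O[atTop] fun s : ℝ => s ^ (-(1 / 2) : ℝ) := by
  refine isBigO_rpow_of_stable (p := fun s => 2 * u (-s)) (g := fun _ => -(1 / 2))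
    (Eventually.of_forall fun s => ?_) hu.eventually_sqrt_le ?_
  · exact ((hu.hasDerivAt_riccatiAdd (-s)).scomp s (hasDerivAt_neg s)).congr_deriv
      (by simp only [smul_eq_mul]; ring)
  · simpa using isBigO_const_const (-(1 / 2) : ℝ) (one_ne_zero' ℝ) atTop

theorem isBigO_riccatiSub :
    (fun s => riccatiSub u (-s)) =O[atTop] fun s : ℝ => s ^ (-(1 / 2) : ℝ) := by
  refine isBigO_rpow_of_unstable (p := fun s => 2 * u (-s)) (g := fun _ => 1 / 2)
    (Eventually.of_forall fun s => ?_) hu.eventually_sqrt_le ?_ ?_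
  · exact ((hu.hasDerivAt_riccatiSub (-s)).scomp s (hasDerivAt_neg s)).congr_deriv
      (by simp only [smul_eq_mul]; ring)
  · simpa using isBigO_const_const (1 / 2 : ℝ) (one_ne_zero' ℝ) atTop
  · have hu_sq := isBigO_rpow_mul hu.isBigO_rpow_half hu.isBigO_rpow_half (c := 1) (by norm_num)
    have hid : (fun s : ℝ => s) =O[atTop] fun s : ℝ => s ^ (1 : ℝ) := by
      simpa using isBigO_refl (fun s : ℝ => s) atTop
    refine IsBigO.trans_isLittleO (g := fun s : ℝ => s ^ (1 : ℝ)) ?_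
      (rpow_isLittleO_exp_mul_rpow_three_halves (by norm_num) 1)
    refine ((((hu.isBigO_riccatiAdd.trans (isBigO_rpow_rpow_of_le (by norm_num))).sub
      (hu_sq.const_mul_left 2))).add hid).congr_left fun s => ?_
    rw [riccatiSub_eq]
    ring

theorem isBigO_deriv : (fun s => deriv u (-s)) =O[atTop] fun s : ℝ => s ^ (-(1 / 2) : ℝ) := by
  refine ((hu.isBigO_riccatiAdd.add hu.isBigO_riccatiSub).const_mul_left (1 / 2)).congr_left
    fun s => ?_
  simp only [riccatiAdd, riccatiSub]
  ring

theorem eventually_pos : ∀ᶠ s in atTop, 0 < u (-s) := by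
  filter_upwards [hu.eventually_sqrt_le, eventually_gt_atTop 0] with s hs hpos
  linarith [Real.sqrt_pos.2 hpos]

theorem hasDerivAt_inv_comp_neg {s : ℝ} (hs : 0 < u (-s)) :
    HasDerivAt (fun s => 1 / 4 * (u (-s))⁻¹) (1 / 4 * (deriv u (-s) * (u (-s))⁻¹ * (u (-s))⁻¹))
      s := by
  refine ((((hu.hasDerivAt (-s)).scomp s (hasDerivAt_neg s)).inv hs.ne').const_mul
    (1 / 4)).congr_deriv ?_
  simp only [smul_eq_mul, Function.comp]
  field_simp

theorem isBigO_deriv_inv : (fun s => 1 / 4 * (deriv u (-s) * (u (-s))⁻¹ * (u (-s))⁻¹))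
    =O[atTop] fun s : ℝ => s ^ (-2 + 1 / 2 : ℝ) :=
  (isBigO_rpow_mul (isBigO_rpow_mul hu.isBigO_deriv hu.isBigO_inv le_rfl) hu.isBigO_inv
    (by norm_num)).const_mul_left _

-- `-1 / (4 u)` balances the right-hand sides of both Riccati equations.
theorem isBigO_riccatiAdd_add :
    (fun s => riccatiAdd u (-s) + 1 / 4 * (u (-s))⁻¹) =O[atTop] fun s : ℝ => s ^ (-2 : ℝ) := by
  refine isBigO_rpow_of_stable (p := fun s => 2 * u (-s)) ?_ hu.eventually_sqrt_le
    hu.isBigO_deriv_inv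
  filter_upwards [hu.eventually_pos] with s hs
  refine (((hu.hasDerivAt_riccatiAdd (-s)).scomp s (hasDerivAt_neg s)).add
    (hu.hasDerivAt_inv_comp_neg hs)).congr_deriv ?_
  simp only [smul_eq_mul]
  field_simp
  ring

theorem isBigO_riccatiSub_add :
    (fun s => riccatiSub u (-s) + 1 / 4 * (u (-s))⁻¹) =O[atTop] fun s : ℝ => s ^ (-2 : ℝ) := by
  refine isBigO_rpow_of_unstable (p := fun s => 2 * u (-s)) ?_ hu.eventually_sqrt_le
    hu.isBigO_deriv_inv ?_
  · filter_upwards [hu.eventually_pos] with s hs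
    refine (((hu.hasDerivAt_riccatiSub (-s)).scomp s (hasDerivAt_neg s)).add
      (hu.hasDerivAt_inv_comp_neg hs)).congr_deriv ?_
    simp only [smul_eq_mul]
    field_simp
    ring
  · exact (hu.isBigO_riccatiSub.add (hu.isBigO_inv.const_mul_left (1 / 4))).trans_isLittleO
      (rpow_isLittleO_exp_mul_rpow_three_halves (by norm_num) _)

theorem isBigO_sq_sub : (fun s => u (-s) ^ 2 - s / 2) =O[atTop] fun s : ℝ => s ^ (-2 : ℝ) := by
  refine ((hu.isBigO_riccatiAdd_add.sub hu.isBigO_riccatiSub_add).const_mul_left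
    (1 / 2)).congr_left fun s => ?_
  rw [riccatiSub_eq]
  ring

theorem isBigO_logDeriv_add :
    (fun s => deriv u (-s) / u (-s) + 1 / (2 * s)) =O[atTop] fun s : ℝ => s ^ (-2 : ℝ) := by
  have hinv : (fun s : ℝ => s⁻¹) =O[atTop] fun s : ℝ => s ^ (-1 : ℝ) := by
    simpa only [Real.rpow_neg_one] using isBigO_refl (fun s : ℝ => s⁻¹) atTop
  have hsum := isBigO_rpow_mul (hu.isBigO_riccatiAdd_add.add hu.isBigO_riccatiSub_add)
    hu.isBigO_inv (c := -2) (by norm_num)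
  have hsq := isBigO_rpow_mul (isBigO_rpow_mul hu.isBigO_sq_sub hinv le_rfl)
    (isBigO_rpow_mul hu.isBigO_inv hu.isBigO_inv le_rfl) (c := -2) (by norm_num)
  refine ((hsum.add hsq).const_mul_left (1 / 2)).congr' ?_ EventuallyEq.rfl
  filter_upwards [hu.eventually_pos, eventually_gt_atTop 0] with s hs hpos
  simp only [riccatiAdd, riccatiSub]
  field_simp
  ring

theorem eventually_riccatiSub_neg : ∀ᶠ t in atBot, riccatiSub u t < 0 := by
  suffices h : ∀ᶠ s in atTop, riccatiSub u (-s) < 0 by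
    simpa only [neg_neg] using tendsto_neg_atBot_atTop.eventually h
  have hsmall := eventually_abs_le_of_isBigO_rpow_neg (a := 3 / 2) (ε := 1 / 4) (by norm_num)
    (by norm_num) (isBigO_rpow_mul hu.isBigO_rpow_half hu.isBigO_riccatiSub_add (by norm_num))
  filter_upwards [hsmall, hu.eventually_pos] with s hs hpos
  rw [mul_add, mul_left_comm, mul_inv_cancel₀ hpos.ne', abs_lt] at hs
  exact neg_of_mul_neg_right (by linarith) hpos.le

theorem continuous : Continuous u := hu.differentiable.continuous

theorem continuous_deriv : Continuous (deriv u) :=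
  continuous_iff_continuousAt.2 fun t => (hu.painleve t).continuousAt

theorem hasDerivAt_integral (t : ℝ) : HasDerivAt (fun t => ∫ x in (0 : ℝ)..t, u x) (u t) t :=
  intervalIntegral.integral_hasDerivAt_right (hu.continuous.intervalIntegrable _ _)
    (hu.continuous.stronglyMeasurableAtFilter _ _) hu.continuous.continuousAt

theorem strictAnti_riccatiSub_mul_exp :
    StrictAnti fun t => riccatiSub u t * Real.exp (2 * ∫ x in (0 : ℝ)..t, u x) := by
  refine strictAnti_of_hasDerivAt_neg (fun t => (hu.hasDerivAt_riccatiSub t).mul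
    ((hu.hasDerivAt_integral t).const_mul 2).exp) fun t => ?_
  linarith [Real.exp_pos (2 * ∫ x in (0 : ℝ)..t, u x)]

theorem strictMono_riccatiAdd_mul_exp :
    StrictMono fun t => riccatiAdd u t * Real.exp (-2 * ∫ x in (0 : ℝ)..t, u x) := by
  refine strictMono_of_hasDerivAt_pos (fun t => (hu.hasDerivAt_riccatiAdd t).mul
    ((hu.hasDerivAt_integral t).const_mul (-2)).exp) fun t => ?_
  linarith [Real.exp_pos (-2 * ∫ x in (0 : ℝ)..t, u x)]

theorem riccatiSub_neg (t : ℝ) : riccatiSub u t < 0 := by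
  obtain ⟨s, hs, hst⟩ := (hu.eventually_riccatiSub_neg.and (eventually_lt_atBot t)).exists
  have hanti := hu.strictAnti_riccatiSub_mul_exp hst
  exact neg_of_mul_neg_left (hanti.trans (mul_neg_of_neg_of_pos hs (Real.exp_pos _)))
    (Real.exp_pos _).le

theorem riccatiAdd_pos_of_lt {w t : ℝ} (hw : riccatiAdd u w = 0) (hwt : w < t) :
    0 < riccatiAdd u t := by
  have hmono := hu.strictMono_riccatiAdd_mul_exp hwt
  exact pos_of_mul_pos_left (by simpa only [hw, zero_mul] using hmono) (Real.exp_pos _).le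

theorem riccatiAdd_neg_of_lt {w t : ℝ} (hw : riccatiAdd u w = 0) (htw : t < w) :
    riccatiAdd u t < 0 := by
  have hmono := hu.strictMono_riccatiAdd_mul_exp htw
  exact neg_of_mul_neg_left (by simpa only [hw, zero_mul] using hmono) (Real.exp_pos _).le

-- `u u'` is monotone where `t + 2 u ^ 2 ≥ 0`; were it positive, `u ^ 2` would grow linearly.
theorem mul_deriv_nonpos {w : ℝ} (hw : ∀ t, w ≤ t → 0 ≤ t + 2 * u t ^ 2) :
    u w * deriv u w ≤ 0 := by
  by_contra! hpos
  have hmono : MonotoneOn (fun t => u t * deriv u t) (Set.Ici w) := by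
    refine monotoneOn_of_hasDerivWithinAt_nonneg (convex_Ici w)
      (hu.continuous.mul hu.continuous_deriv).continuousOn
      (fun t _ => ((hu.hasDerivAt t).mul (hu.painleve t)).hasDerivWithinAt) fun t ht => ?_
    nlinarith [mul_nonneg (sq_nonneg (u t)) (hw t (interior_subset ht)), sq_nonneg (deriv u t)]
  have hgrowth : ∀ t, w ≤ t → 2 * (u w * deriv u w) * (t - w) ≤ u t ^ 2 - u w ^ 2 := fun t ht =>
    (convex_Ici w).mul_sub_le_image_sub_of_le_deriv (hu.continuous.pow 2).continuousOn
      (hu.differentiable.pow 2).differentiableOn (fun x hx => by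
        have hle := hmono (le_refl w) (interior_subset hx) (interior_subset hx)
        rw [((hu.hasDerivAt x).pow 2).deriv, pow_one]
        push_cast
        linarith) w Set.self_mem_Ici t ht ht
  have hlim : Tendsto (fun t => 2 * (u w * deriv u w) * (t - w)) atTop atTop :=
    (tendsto_atTop_add_const_right _ (-w) tendsto_id).const_mul_atTop (by positivity)
  have hu_sq : ∀ᶠ t in atTop, u t ^ 2 - u w ^ 2 < 1 :=
    ((hu.tendsto_atTop.pow 2).sub_const (u w ^ 2)).eventually_lt_const
      (by nlinarith [sq_nonneg (u w)])
  obtain ⟨t, ⟨htlim, htu⟩, ht⟩ :=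
    (((hlim.eventually_ge_atTop 1).and hu_sq).and (eventually_ge_atTop w)).exists
  linarith [hgrowth t ht]

theorem deriv_neg_of_riccatiAdd_nonpos {t : ℝ} (ht : riccatiAdd u t ≤ 0) : deriv u t < 0 := by
  have hB := hu.riccatiSub_neg t
  simp only [riccatiAdd, riccatiSub] at ht hB
  linarith

theorem neg_of_deriv_neg {t w : ℝ} (hderiv : ∀ x ∈ Set.Ioo t w, deriv u x < 0) (htw : t < w)
    (ht : u t = 0) : u w < 0 :=
  ht ▸ strictAntiOn_of_deriv_neg (convex_Icc t w) hu.continuous.continuousOn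
    (by rwa [interior_Icc]) (Set.left_mem_Icc.2 htw.le) (Set.right_mem_Icc.2 htw.le) htw

theorem exists_riccatiAdd_eq_zero {t : ℝ} (ht : u t = 0) (hneg : riccatiAdd u t < 0) :
    ∃ w, t < w ∧ riccatiAdd u w = 0 := by
  by_contra! hne
  have hneg' : ∀ x, t ≤ x → riccatiAdd u x < 0 := by
    intro x hx
    by_contra! hpos
    obtain ⟨w, hw, hw0⟩ := intermediate_value_Icc hx (fun x _ =>
      (hu.hasDerivAt_riccatiAdd x).continuousAt.continuousWithinAt) ⟨hneg.le, hpos⟩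
    exact hne w (hw.1.lt_of_ne (by rintro rfl; exact hneg.ne hw0)) hw0
  have hanti : StrictAntiOn u (Set.Ici t) :=
    strictAntiOn_of_deriv_neg (convex_Ici t) hu.continuous.continuousOn fun x hx =>
      hu.deriv_neg_of_riccatiAdd_nonpos (hneg' x (interior_subset hx)).le
  have hlt : u (t + 1) < 0 := ht ▸ hanti Set.self_mem_Ici (by simp) (by simp)
  refine hlt.not_ge (le_of_tendsto hu.tendsto_atTop ?_)
  filter_upwards [eventually_ge_atTop (t + 1)] with x hx
  have htx : t ≤ x := by linarith
  exact hanti.antitoneOn (by simp) htx hx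

theorem ne_zero_of_neg {t : ℝ} (ht : t < 0) : u t ≠ 0 := by
  intro hut
  have hB := hu.riccatiSub_neg t
  have hA : riccatiAdd u t < 0 := by
    rw [riccatiSub_eq, hut] at hB
    linarith
  obtain ⟨w, htw, hw⟩ := hu.exists_riccatiAdd_eq_zero hut hA
  have huw : u w < 0 := hu.neg_of_deriv_neg (fun x hx =>
    hu.deriv_neg_of_riccatiAdd_nonpos (hu.riccatiAdd_neg_of_lt hw hx.2).le) htw hut
  refine (hu.mul_deriv_nonpos fun x hx => ?_).not_gt
    (mul_pos_of_neg_of_neg huw (hu.deriv_neg_of_riccatiAdd_nonpos hw.le))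
  have hAx : 0 ≤ riccatiAdd u x := by
    rcases hx.eq_or_lt with rfl | hwx
    · exact hw.ge
    · exact (hu.riccatiAdd_pos_of_lt hw hwx).le
  linarith [hu.riccatiSub_neg x, riccatiSub_eq u x]

theorem deriv_ne_zero_of_eq_zero {t : ℝ} (ht : u t = 0) : deriv u t ≠ 0 := by
  intro ht'
  obtain ⟨M, hM⟩ := (isCompact_uIcc (a := t) (b := 0)).exists_bound_of_continuousOn
    (f := fun x => x + 2 * u x ^ 2)
    (continuous_id.add ((hu.continuous.pow 2).const_mul 2)).continuousOn
  have hgronwall := norm_le_norm_mul_exp (f := fun x => (u x, deriv u x)) (K := max 1 M)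
    (a := t) (b := 0)
    (fun x _ => ((hu.hasDerivAt x).prodMk (hu.painleve x)).hasDerivWithinAt) fun x hx => by
      have hfactor : x * u x + 2 * u x ^ 3 = (x + 2 * u x ^ 2) * u x := by ring
      rw [Prod.norm_mk, hfactor, norm_mul]
      refine max_le ?_ (mul_le_mul ((hM x hx).trans (le_max_right _ _))
        (norm_fst_le (u x, deriv u x)) (norm_nonneg _) (by positivity))
      exact (norm_snd_le (u x, deriv u x)).trans
        (le_mul_of_one_le_left (norm_nonneg _) (le_max_left _ _))
  rw [ht, ht', Prod.mk_zero_zero, norm_zero, zero_mul, norm_le_zero_iff, Prod.mk_eq_zero]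
    at hgronwall
  have hB := hu.riccatiSub_neg 0
  simp [riccatiSub, hgronwall.1, hgronwall.2] at hB

theorem ne_zero (t : ℝ) : u t ≠ 0 := by
  rcases lt_or_ge t 0 with ht | ht
  · exact hu.ne_zero_of_neg ht
  intro hut
  have hanti : AntitoneOn (fun x => u x ^ 2) (Set.Ici t) := by
    refine antitoneOn_of_hasDerivWithinAt_nonpos (convex_Ici t)
      (hu.continuous.pow 2).continuousOn
      (fun x _ => ((hu.hasDerivAt x).fun_pow 2).hasDerivWithinAt) fun x hx => ?_
    have hx0 : 0 ≤ x := ht.trans (interior_subset hx)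
    have := hu.mul_deriv_nonpos fun y (hy : x ≤ y) => by nlinarith [sq_nonneg (u y)]
    rw [pow_one]
    push_cast
    linarith
  have hzero : ∀ x, t ≤ x → u x = 0 := fun x hx => by
    have := hanti Set.self_mem_Ici hx hx
    simp only [hut] at this
    exact pow_eq_zero_iff (two_ne_zero) |>.1 (by nlinarith [sq_nonneg (u x)])
  have hderiv : deriv u (t + 1) = 0 := by
    have hev : u =ᶠ[𝓝 (t + 1)] fun _ => 0 :=
      mem_of_superset (Ici_mem_nhds (lt_add_one t)) hzero
    rw [hev.deriv_eq, deriv_const]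
  exact hu.deriv_ne_zero_of_eq_zero (hzero (t + 1) (by simp)) hderiv

theorem continuous_logDeriv : Continuous fun t => deriv u t / u t :=
  hu.continuous_deriv.div hu.continuous hu.ne_zero

end IsHastingsMcLeod

/-- The increment of the right-hand side of the `q₂`-`α` system when `(q, α)` is displaced by `z`;
`r` stands for `u' / u` and `k` for `u ^ 2 + t / 2`. -/
noncomputable def qAlphaIncrement (r k q α : ℝ) (z : ℝ × ℝ) : ℝ × ℝ :=
  ((2 / 3 * α + r / 3 * (1 - 2 * q) + 2 / 3 * z.2 - r / 3 * z.1) * z.1 + 2 / 3 * q * z.2,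
    (4 / 3 * α + r / 3 * (2 - q) + 2 / 3 * z.2 - r / 3 * z.1) * z.2 - (r / 3 * α + k / 3) * z.1)

theorem qAlphaIncrement_zero (r k q α : ℝ) : qAlphaIncrement r k q α 0 = 0 := by
  simp [qAlphaIncrement]

theorem exists_lipschitzOnWith_qAlphaIncrement (M : ℝ) :
    ∃ L : NNReal, ∀ r k q α : ℝ, |r| ≤ M → |k| ≤ M → |q| ≤ M → |α| ≤ M →
      LipschitzOnWith L (qAlphaIncrement r k q α) (Metric.closedBall 0 M) := by
  set F : (ℝ × ℝ × ℝ × ℝ) × ℝ × ℝ → ℝ × ℝ :=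
    fun p => qAlphaIncrement p.1.1 p.1.2.1 p.1.2.2.1 p.1.2.2.2 p.2 with hF
  have hF₁ : ContDiff ℝ 1 F := by
    simp only [hF, qAlphaIncrement]
    fun_prop
  obtain ⟨L, hL⟩ := hF₁.contDiffOn.exists_lipschitzOnWith one_ne_zero
    (convex_closedBall 0 M) (isCompact_closedBall 0 M)
  refine ⟨L, fun r k q α hr hk hq hα z hz w hw => ?_⟩
  have hmem : ∀ z ∈ Metric.closedBall (0 : ℝ × ℝ) M, ((r, k, q, α), z) ∈ Metric.closedBall 0 M :=
    fun z hz => mem_closedBall_zero_iff.2 <| max_le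
      (max_le hr (max_le hk (max_le hq hα))) (mem_closedBall_zero_iff.1 hz)
  simpa [hF, Prod.edist_eq] using hL (hmem z hz) (hmem w hw)

/-- The time-dependent vector field governing the displacement of a solution of the `q₂`-`α`
system from the reference solution `(q, α)`. -/
noncomputable def incrementField (u q α : ℝ → ℝ) (t : ℝ) : ℝ × ℝ → ℝ × ℝ :=
  qAlphaIncrement (deriv u t / u t) (u t ^ 2 + t / 2) (q t) (α t)

section SolutionOn

variable {u q α p β : ℝ → ℝ} {S T : Set ℝ}

namespace IsQAlphaSolutionOn

theorem mono (h : IsQAlphaSolutionOn u q α S) (hTS : T ⊆ S) : IsQAlphaSolutionOn u q α T :=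
  ⟨fun t ht => (h.deriv_q t (hTS ht)).mono hTS, fun t ht => (h.deriv_α t (hTS ht)).mono hTS⟩

theorem continuousOn_q (h : IsQAlphaSolutionOn u q α S) : ContinuousOn q S :=
  fun t ht => (h.deriv_q t ht).continuousWithinAt

theorem continuousOn_α (h : IsQAlphaSolutionOn u q α S) : ContinuousOn α S :=
  fun t ht => (h.deriv_α t ht).continuousWithinAt

theorem isIntegralCurveOn_sub (h : IsQAlphaSolutionOn u q α S) (h' : IsQAlphaSolutionOn u p β S) :
    IsIntegralCurveOn (fun t => (p t - q t, β t - α t)) (incrementField u q α) S := by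
  intro t ht
  refine (((h'.deriv_q t ht).sub (h.deriv_q t ht)).prodMk
    ((h'.deriv_α t ht).sub (h.deriv_α t ht))).congr_deriv ?_
  simp only [incrementField, qAlphaIncrement]
  exact Prod.ext (by ring) (by ring)

theorem add_isIntegralCurveOn (h : IsQAlphaSolutionOn u q α S) {z : ℝ → ℝ × ℝ}
    (hz : IsIntegralCurveOn z (incrementField u q α) S) :
    IsQAlphaSolutionOn u (fun t => q t + (z t).1) (fun t => α t + (z t).2) S := by
  refine ⟨fun t ht => ?_, fun t ht => ?_⟩
  · refine ((h.deriv_q t ht).add (hz t ht).fst).congr_deriv ?_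
    simp only [incrementField, qAlphaIncrement]
    ring
  · refine ((h.deriv_α t ht).add (hz t ht).snd).congr_deriv ?_
    simp only [incrementField, qAlphaIncrement]
    ring

end IsQAlphaSolutionOn

theorem exists_lipschitzOnWith_incrementField (hu : IsHastingsMcLeod u) (hT : IsCompact T)
    (hq : ContinuousOn q T) (hα : ContinuousOn α T) (ρ : ℝ) :
    ∃ L : NNReal, ∀ t ∈ T, LipschitzOnWith L (incrementField u q α t) (Metric.closedBall 0 ρ) := by
  have hr := hu.continuous_logDeriv.continuousOn (s := T)
  have hk : ContinuousOn (fun t => u t ^ 2 + t / 2) T := by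
    have := hu.continuous
    fun_prop
  obtain ⟨M, hM⟩ := hT.exists_bound_of_continuousOn (hr.prodMk (hk.prodMk (hq.prodMk hα)))
  obtain ⟨L, hL⟩ := exists_lipschitzOnWith_qAlphaIncrement (max M ρ)
  refine ⟨L, fun t ht => ?_⟩
  have hMt := hM t ht
  simp only [Prod.norm_mk, max_le_iff, Real.norm_eq_abs] at hMt
  obtain ⟨hrt, hkt, hqt, hαt⟩ := hMt
  have hMρ := le_max_left M ρ
  exact (hL _ _ _ _ (hrt.trans hMρ) (hkt.trans hMρ) (hqt.trans hMρ) (hαt.trans hMρ)).mono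
    (Metric.closedBall_subset_closedBall (le_max_right M ρ))

theorem norm_incrementField_le {L : NNReal} {ρ t : ℝ} {z : ℝ × ℝ}
    (hL : LipschitzOnWith L (incrementField u q α t) (Metric.closedBall 0 ρ)) (hz : ‖z‖ ≤ ρ) :
    ‖incrementField u q α t z‖ ≤ L * ‖z‖ := by
  have h := hL.norm_sub_le (mem_closedBall_zero_iff.2 hz)
    (Metric.mem_closedBall_self ((norm_nonneg z).trans hz))
  rwa [incrementField, qAlphaIncrement_zero, sub_zero, sub_zero] at h

theorem IsQAlphaSolutionOn.eqOn (hu : IsHastingsMcLeod u) (hS : S.OrdConnected) {t₁ : ℝ}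
    (ht₁ : t₁ ∈ S) (h : IsQAlphaSolutionOn u q α S) (h' : IsQAlphaSolutionOn u p β S)
    (hq : p t₁ = q t₁) (hα : β t₁ = α t₁) : Set.EqOn p q S ∧ Set.EqOn β α S := by
  suffices hzero : ∀ t ∈ S, (p t - q t, β t - α t) = 0 from
    ⟨fun t ht => sub_eq_zero.1 (congrArg Prod.fst (hzero t ht)),
      fun t ht => sub_eq_zero.1 (congrArg Prod.snd (hzero t ht))⟩
  intro t ht
  have hsub : Set.uIcc t₁ t ⊆ S := hS.uIcc_subset ht₁ ht
  have hz := (h.mono hsub).isIntegralCurveOn_sub (h'.mono hsub)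
  obtain ⟨ρ, hρ⟩ := isCompact_uIcc.exists_bound_of_continuousOn
    fun s hs => (hz s hs).continuousWithinAt
  obtain ⟨L, hL⟩ := exists_lipschitzOnWith_incrementField hu isCompact_uIcc
    (h.continuousOn_q.mono hsub) (h.continuousOn_α.mono hsub) ρ
  have hgronwall := norm_le_norm_mul_exp hz
    fun s hs => norm_incrementField_le (hL s hs) (hρ s hs)
  simpa [hq, hα] using hgronwall

end SolutionOn

/-- Coordinatewise truncation to `[-1, 1]`, that is, to the closed unit ball of the sup norm. -/
noncomputable def clip (z : ℝ × ℝ) : ℝ × ℝ :=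
  (max (-1) (min z.1 1), max (-1) (min z.2 1))

theorem lipschitzWith_clip : LipschitzWith 1 clip := by
  have h := ((LipschitzWith.id (α := ℝ)).min_const 1).const_max (-1)
  exact ((h.comp LipschitzWith.prod_fst).prodMk (h.comp LipschitzWith.prod_snd)).weaken (by simp)

theorem norm_clip_le_one (z : ℝ × ℝ) : ‖clip z‖ ≤ 1 := by
  have h : ∀ x : ℝ, |max (-1) (min x 1)| ≤ 1 := fun x =>
    abs_le.2 ⟨le_max_left _ _, max_le (by norm_num) (min_le_right _ _)⟩
  exact max_le (h z.1) (h z.2)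

theorem clip_eq_self {z : ℝ × ℝ} (hz : ‖z‖ ≤ 1) : clip z = z := by
  have h : ∀ x : ℝ, |x| ≤ 1 → max (-1) (min x 1) = x := fun x hx => by
    rw [min_eq_left (abs_le.1 hx).2, max_eq_right (abs_le.1 hx).1]
  exact Prod.ext (h z.1 ((norm_fst_le z).trans hz)) (h z.2 ((norm_snd_le z).trans hz))

theorem norm_clip_le_norm (z : ℝ × ℝ) : ‖clip z‖ ≤ ‖z‖ := by
  simpa [clip_eq_self] using lipschitzWith_clip.norm_sub_le z 0

section Truncated

variable {u q α : ℝ → ℝ} {t₀ t₁ : ℝ}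

theorem exists_isIntegralCurveOn_clip (hu : IsHastingsMcLeod u)
    (h : IsQAlphaSolutionOn u q α (Set.Iic t₀)) (ht₁ : t₁ ≤ t₀) (z₁ : ℝ × ℝ) :
    ∃ z : ℝ → ℝ × ℝ, z t₁ = z₁ ∧
      IsIntegralCurveOn z (fun t w => incrementField u q α t (clip w)) (Set.Iic t₀) := by
  refine exists_isIntegralCurveOn_Iic ht₁ (fun w => ?_) (fun T => ?_) z₁
  · have hr := hu.continuous_logDeriv.continuousOn (s := Set.Iic t₀)
    have hu := hu.continuous
    have hq := h.continuousOn_q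
    have hα := h.continuousOn_α
    simp only [incrementField, qAlphaIncrement]
    fun_prop
  · obtain ⟨L, hL⟩ := exists_lipschitzOnWith_incrementField hu (isCompact_Icc (a := T) (b := t₀))
      (h.continuousOn_q.mono Set.Icc_subset_Iic_self)
      (h.continuousOn_α.mono Set.Icc_subset_Iic_self) 1
    refine ⟨L, L, fun t ht => ⟨?_, fun w => ?_⟩⟩
    · have hcomp := (hL t ht).comp (lipschitzWith_clip.lipschitzOnWith (s := Set.univ))
        fun w _ => mem_closedBall_zero_iff.2 (norm_clip_le_one w)
      rwa [mul_one, lipschitzOnWith_univ] at hcomp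
    · exact (norm_incrementField_le (hL t ht) (norm_clip_le_one w)).trans
        (mul_le_of_le_one_right L.2 (norm_clip_le_one w))

theorem exists_norm_le_mul_of_isIntegralCurveOn_clip (hu : IsHastingsMcLeod u)
    (h : IsQAlphaSolutionOn u q α (Set.Iic t₀)) {T : ℝ} (ht₁ : t₁ ∈ Set.Icc T t₀) :
    ∃ K : ℝ, 0 < K ∧ ∀ z : ℝ → ℝ × ℝ,
      IsIntegralCurveOn z (fun t w => incrementField u q α t (clip w)) (Set.Iic t₀) →
      ∀ t ∈ Set.Icc T t₀, ‖z t‖ ≤ K * ‖z t₁‖ := by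
  obtain ⟨L, hL⟩ := exists_lipschitzOnWith_incrementField hu (isCompact_Icc (a := T) (b := t₀))
    (h.continuousOn_q.mono Set.Icc_subset_Iic_self)
    (h.continuousOn_α.mono Set.Icc_subset_Iic_self) 1
  refine ⟨Real.exp (L * (t₀ - T)), Real.exp_pos _, fun z hz t ht => ?_⟩
  have hsub : Set.uIcc t₁ t ⊆ Set.Icc T t₀ := Set.ordConnected_Icc.uIcc_subset ht₁ ht
  have hgronwall := norm_le_norm_mul_exp (K := L)
    (fun s hs => (hz s (hsub hs).2).mono fun x hx => (hsub hx).2) fun s hs =>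
      (norm_incrementField_le (hL s (hsub hs)) (norm_clip_le_one _)).trans
        (mul_le_mul_of_nonneg_left (norm_clip_le_norm _) L.2)
  rw [mul_comm]
  refine hgronwall.trans (mul_le_mul_of_nonneg_left (Real.exp_le_exp.2 ?_) (norm_nonneg _))
  exact mul_le_mul_of_nonneg_left
    (abs_le.2 ⟨by linarith [ht.1, ht₁.2], by linarith [ht.2, ht₁.1]⟩) L.2

end Truncated

/-- The coefficients `r`, `k`, `q`, `α` of `qAlphaIncrement` at `t = -s` have their leading
asymptotic values as `s → ∞`, up to errors controlled by `M`, and `s` is large compared to `M`. -/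
structure IsFarField (M s r k q α : ℝ) : Prop where
  one_le : 1 ≤ M
  le_s : 8 * M ^ 2 ≤ s
  abs_r : |r + 1 / (2 * s)| ≤ M / s ^ 2
  abs_k : |k| ≤ M / s ^ 2
  abs_q : |q| ≤ M / s
  abs_α : |α - (√2 / 2 * √s - 1 / (8 * s))| ≤ M / s ^ 2

theorem abs_mul_le_of_le {a b x y : ℝ} (ha : |a| ≤ x) (hb : |b| ≤ y) : |a * b| ≤ x * y := by
  rw [abs_mul]
  exact mul_le_mul ha hb (abs_nonneg b) ((abs_nonneg a).trans ha)

section FarField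

variable {M s r k q α n : ℝ} {z : ℝ × ℝ}

theorem abs_mul_snd_le (hQ : |z.1| ≤ n) (hR : |s * z.2 + z.1 / 4| ≤ n) : |s * z.2| ≤ 2 * n := by
  rw [abs_le] at *
  constructor <;> linarith

theorem abs_snd_le (hs : 0 < s) (hQ : |z.1| ≤ n) (hR : |s * z.2 + z.1 / 4| ≤ n) :
    |z.2| ≤ 2 * n / s := by
  have h := abs_mul_snd_le hQ hR
  rwa [abs_mul, abs_of_pos hs, ← le_div_iff₀' hs] at h

namespace IsFarField

theorem eight_le (h : IsFarField M s r k q α) : 8 ≤ s := by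
  nlinarith [h.one_le, h.le_s]

theorem pos (h : IsFarField M s r k q α) : 0 < s := by
  linarith [h.eight_le]

theorem sqrt_pos (h : IsFarField M s r k q α) : 0 < √s :=
  Real.sqrt_pos.2 h.pos

theorem sqrt_le (h : IsFarField M s r k q α) : √s ≤ s :=
  Real.sqrt_le_iff.2 ⟨h.pos.le, le_self_pow₀ (by linarith [h.eight_le]) two_ne_zero⟩

theorem sq_div_sq_le (h : IsFarField M s r k q α) : M ^ 2 / s ^ 2 ≤ 1 / s / 8 := by
  have hs := h.pos
  rw [div_div, div_le_div_iff₀ (by positivity) (by positivity)]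
  nlinarith [h.le_s]

theorem div_sq_le (h : IsFarField M s r k q α) : M / s ^ 2 ≤ 1 / s / 8 :=
  (div_le_div_of_nonneg_right (le_self_pow₀ h.one_le two_ne_zero) (sq_nonneg s)).trans
    h.sq_div_sq_le

theorem one_div_le (h : IsFarField M s r k q α) : 1 / s ≤ M / s :=
  div_le_div_of_nonneg_right h.one_le h.pos.le

theorem abs_r_le (h : IsFarField M s r k q α) : |r| ≤ M / s := by
  have hhalf : 1 / (2 * s) = 1 / s / 2 := by ring
  have hpos : 0 < 1 / s := one_div_pos.2 h.pos
  have herr := abs_le.1 (h.abs_r.trans h.div_sq_le)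
  have hMs := h.one_div_le
  exact abs_le.2 ⟨by linarith, by linarith⟩

theorem abs_α_le (h : IsFarField M s r k q α) : |α| ≤ √s := by
  have hs := h.pos
  have hs8 := h.eight_le
  have hσ : 1 ≤ √s := Real.one_le_sqrt.2 (by linarith)
  have hsmall : 1 / s ≤ 1 / 8 := by gcongr
  have heighth : 1 / (8 * s) = 1 / s / 8 := by ring
  have hpos : 0 < 1 / s := one_div_pos.2 hs
  have h2 : √2 ≤ 3 / 2 := Real.sqrt_le_iff.2 ⟨by norm_num, by norm_num⟩
  have hlead : √2 / 2 * √s ≤ 3 / 2 / 2 * √s := by gcongr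
  have hlead₀ : 0 ≤ √2 / 2 * √s := by positivity
  have herr := abs_le.1 (h.abs_α.trans h.div_sq_le)
  exact abs_le.2 ⟨by linarith, by linarith⟩

theorem abs_slow_sub_le (h : IsFarField M s r k q α) (hQ : |z.1| ≤ n)
    (hR : |s * z.2 + z.1 / 4| ≤ n) :
    |-(qAlphaIncrement r k q α z).1 - (1 / (4 * s) - √2 / 3 * √s) * z.1|
      ≤ 10 * M ^ 2 * (n / s ^ 2 + n ^ 2 / s) := by
  have hs := h.pos
  have hM := h.one_le
  have hn : 0 ≤ n := (abs_nonneg _).trans hQ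
  have hsplit : -(qAlphaIncrement r k q α z).1 - (1 / (4 * s) - √2 / 3 * √s) * z.1
      = -(2 / 3) * ((α - (√2 / 2 * √s - 1 / (8 * s))) * z.1) - 1 / 3 * ((r + 1 / (2 * s)) * z.1)
        + 2 / 3 * (r * q * z.1) - 2 / 3 * (q * z.2) - 2 / 3 * (z.2 * z.1)
        + 1 / 3 * (r * (z.1 * z.1)) := by
    simp only [qAlphaIncrement]
    ring
  have hP := abs_snd_le hs hQ hR
  have hα := abs_le.1 (abs_mul_le_of_le h.abs_α hQ)
  have hr := abs_le.1 (abs_mul_le_of_le h.abs_r hQ)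
  have hrq := abs_le.1 (abs_mul_le_of_le (abs_mul_le_of_le h.abs_r_le h.abs_q) hQ)
  have hqP := abs_le.1 (abs_mul_le_of_le h.abs_q hP)
  have hPQ := abs_le.1 (abs_mul_le_of_le hP hQ)
  have hrQ := abs_le.1 (abs_mul_le_of_le h.abs_r_le (abs_mul_le_of_le hQ hQ))
  have hMM : M ≤ M ^ 2 := le_self_pow₀ hM two_ne_zero
  have hlin : M * (n / s ^ 2) ≤ M ^ 2 * (n / s ^ 2) := by gcongr
  have hquad : M * (n ^ 2 / s) ≤ M ^ 2 * (n ^ 2 / s) := by gcongr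
  have hquad' : n ^ 2 / s ≤ M * (n ^ 2 / s) := le_mul_of_one_le_left (by positivity) hM
  ring_nf at hα hr hrq hqP hPQ hrQ hlin hquad hquad' hsplit ⊢
  rw [hsplit]
  exact abs_le.2 ⟨by linarith, by linarith⟩

theorem abs_fast_coeff_snd_le (h : IsFarField M s r k q α) :
    |1 / (2 * s) - 4 / 3 * (α - (√2 / 2 * √s - 1 / (8 * s))) - 2 / 3 * (r + 1 / (2 * s))
        + r * q / 3| ≤ 1 / s := by
  have hs := h.pos
  have hα := abs_le.1 (h.abs_α.trans h.div_sq_le)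
  have hr := abs_le.1 (h.abs_r.trans h.div_sq_le)
  have hMM : M / s * (M / s) = M ^ 2 / s ^ 2 := by ring
  have hrq := abs_le.1 ((abs_mul_le_of_le h.abs_r_le h.abs_q).trans (hMM.trans_le h.sq_div_sq_le))
  have hhalf : 1 / (2 * s) = 1 / s / 2 := by ring
  have hpos : 0 < 1 / s := one_div_pos.2 hs
  exact abs_le.2 ⟨by linarith, by linarith⟩

theorem abs_fast_coeff_fst_le (h : IsFarField M s r k q α) :
    |s * (r + 1 / (2 * s)) * α / 3 + 1 / (48 * s) - (α - (√2 / 2 * √s - 1 / (8 * s))) / 6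
        + s * k / 3| ≤ M / √s := by
  have hs := h.pos
  have hscaled {x : ℝ} (hx : |x| ≤ M / s ^ 2) : |s * x| ≤ M / s := by
    have hdiv : s * (M / s ^ 2) = M / s := by field_simp
    rw [abs_mul, abs_of_pos hs, ← hdiv]
    gcongr
  have hrα := abs_le.1 (abs_mul_le_of_le (hscaled h.abs_r) h.abs_α_le)
  have hroot : M / s * √s = M / √s := by
    rw [div_mul_eq_mul_div, mul_div_assoc, Real.sqrt_div_self, div_eq_mul_inv]
  have hk := abs_le.1 (hscaled h.abs_k)
  have hα := abs_le.1 (h.abs_α.trans h.div_sq_le)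
  have h48 : 1 / (48 * s) = 1 / s / 48 := by ring
  have hpos : 0 < 1 / s := one_div_pos.2 hs
  have hMs := h.one_div_le
  have hMσ : M / s ≤ M / √s :=
    div_le_div_of_nonneg_left (by linarith [h.one_le]) h.sqrt_pos h.sqrt_le
  rw [hroot] at hrα
  exact abs_le.2 ⟨by linarith, by linarith⟩

theorem abs_fast_quadratic_le (h : IsFarField M s r k q α) (hQ : |z.1| ≤ n)
    (hR : |s * z.2 + z.1 / 4| ≤ n) :
    |(2 / 3 * z.2 - r / 3 * z.1) * (s * z.2)| ≤ 4 * M ^ 2 * (n ^ 2 / s) := by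
  have hs := h.pos
  have hy := abs_mul_snd_le hQ hR
  have hPy := abs_le.1 (abs_mul_le_of_le (abs_snd_le hs hQ hR) hy)
  have hrQy := abs_le.1 (abs_mul_le_of_le (abs_mul_le_of_le h.abs_r_le hQ) hy)
  have hM : 1 ≤ M ^ 2 := one_le_pow₀ h.one_le
  have hMM : M ≤ M ^ 2 := le_self_pow₀ h.one_le two_ne_zero
  have hsM : M * (n ^ 2 / s) ≤ M ^ 2 * (n ^ 2 / s) := by gcongr
  have hs1 : n ^ 2 / s ≤ M ^ 2 * (n ^ 2 / s) := le_mul_of_one_le_left (by positivity) hM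
  ring_nf at hPy hrQy hsM hs1 ⊢
  exact abs_le.2 ⟨by linarith, by linarith⟩

theorem exists_fast_add_eq (h : IsFarField M s r k q α) (hQ : |z.1| ≤ n)
    (hR : |s * z.2 + z.1 / 4| ≤ n) :
    ∃ X A B : ℝ, |X| ≤ 10 * M ^ 2 * (n / s ^ 2 + n ^ 2 / s) ∧ |A| ≤ 1 / s ∧ |B| ≤ M / √s ∧
      z.2 - s * (qAlphaIncrement r k q α z).2 - (qAlphaIncrement r k q α z).1 / 4
          + 2 * (√2 / 3 * √s) * (s * z.2 + z.1 / 4)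
        = z.2 + A * (s * z.2) - (2 / 3 * z.2 - r / 3 * z.1) * (s * z.2)
          + B * z.1 + z.1 * (1 / s) / 16 + X / 4 := by
  refine ⟨_, _, _, h.abs_slow_sub_le hQ hR, h.abs_fast_coeff_snd_le, h.abs_fast_coeff_fst_le, ?_⟩
  have hs := h.pos.ne'
  simp only [qAlphaIncrement]
  field_simp
  ring

theorem abs_fast_add_le (h : IsFarField M s r k q α) (hQ : |z.1| ≤ n)
    (hR : |s * z.2 + z.1 / 4| ≤ n) :
    |z.2 - s * (qAlphaIncrement r k q α z).2 - (qAlphaIncrement r k q α z).1 / 4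
        + 2 * (√2 / 3 * √s) * (s * z.2 + z.1 / 4)|
      ≤ 10 * M ^ 2 * (n / √s + n ^ 2 / s) := by
  have hs := h.pos
  have hM := h.one_le
  have hn : 0 ≤ n := (abs_nonneg _).trans hQ
  have hσ := h.sqrt_pos
  have hσs := h.sqrt_le
  obtain ⟨X, A, B, hX, hA, hB, hsplit⟩ := h.exists_fast_add_eq hQ hR
  have hP := abs_le.1 (abs_snd_le hs hQ hR)
  have hquad := abs_le.1 (h.abs_fast_quadratic_le hQ hR)
  have hAy := abs_le.1 (abs_mul_le_of_le hA (abs_mul_snd_le hQ hR))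
  have hBQ := abs_le.1 (abs_mul_le_of_le hB hQ)
  have hQs := abs_le.1 (abs_mul_le_of_le hQ (abs_of_pos (one_div_pos.2 hs)).le)
  have hlin : n / s ≤ n / √s := div_le_div_of_nonneg_left hn hσ hσs
  have hlin' : M ^ 2 * (n / s ^ 2) ≤ M ^ 2 * (n / √s) := by
    gcongr
    exact hσs.trans (le_self_pow₀ (by linarith [h.eight_le]) two_ne_zero)
  have hMM : M ≤ M ^ 2 := le_self_pow₀ hM two_ne_zero
  have hσM : M * (n / √s) ≤ M ^ 2 * (n / √s) := by gcongr
  have hσ1' : n / √s ≤ M * (n / √s) := le_mul_of_one_le_left (by positivity) hM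
  rw [abs_le] at hX
  rw [hsplit]
  ring_nf at hP hX hquad hAy hBQ hQs hlin hlin' hσM hσ1' ⊢
  exact abs_le.2 ⟨by linarith, by linarith⟩

end IsFarField

end FarField

theorem mul_div_le_mul_sq_add_sq_div {σ : ℝ} (hσ : 0 < σ) (x y : ℝ) :
    x * (y / σ) ≤ 1 / 4 * (σ * x ^ 2) + y ^ 2 / (σ ^ 2 * σ) := by
  have hsq : 0 ≤ σ * (x / 2 - y / σ ^ 2) ^ 2 := by positivity
  have hexpand : σ * (x / 2 - y / σ ^ 2) ^ 2
      = 1 / 4 * (σ * x ^ 2) + y ^ 2 / (σ ^ 2 * σ) - x * (y / σ) := by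
    field_simp
    ring
  linarith

-- The forcing of the fast mode is absorbed, by AM-GM, into half of its damping.
theorem dissipation_le {c s D n Q R Q' R' : ℝ} (hc : 1 / 4 ≤ c) (hs : 1 ≤ s) (hD : 0 ≤ D)
    (hn : 0 ≤ n) (hQR : n ^ 2 = Q ^ 2 + R ^ 2)
    (hQ : |Q' - (1 / (4 * s) - c * √s) * Q| ≤ D * (n / s ^ 2 + n ^ 2 / s))
    (hR : |R' + 2 * (c * √s) * R| ≤ D * (n / √s + n ^ 2 / s)) :
    Q * Q' + R * R'
      ≤ (1 / (4 * s) - c * √s + (D + D ^ 2) / (s * √s) + 2 * D * n / s) * n ^ 2 := by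
  obtain ⟨σ, hσ, rfl⟩ : ∃ σ, 0 < σ ∧ s = σ ^ 2 :=
    ⟨√s, Real.sqrt_pos.2 (by linarith), (Real.sq_sqrt (by linarith)).symm⟩
  rw [Real.sqrt_sq hσ.le] at *
  have hσ1 : 1 ≤ σ := by nlinarith
  have hQn : |Q| ≤ n := abs_le_of_sq_le_sq (by nlinarith) hn
  have hRn : |R| ≤ n := abs_le_of_sq_le_sq (by nlinarith) hn
  have hslow := (le_abs_self _).trans (abs_mul_le_of_le hQn hQ)
  have hfast : R * (R' + 2 * (c * σ) * R) ≤ |R| * (D * n / σ) + n * (D * (n ^ 2 / σ ^ 2)) := by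
    refine (le_abs_self _).trans ((abs_mul_le_of_le le_rfl hR).trans ?_)
    have := mul_le_mul_of_nonneg_right hRn (by positivity : 0 ≤ D * (n ^ 2 / σ ^ 2))
    linarith [(by ring : |R| * (D * (n / σ)) = |R| * (D * n / σ))]
  have hcross : |R| * (D * n / σ) ≤ c * (σ * R ^ 2) + D ^ 2 / (σ ^ 2 * σ) * n ^ 2 := by
    have hamgm := mul_div_le_mul_sq_add_sq_div hσ |R| (D * n)
    rw [sq_abs, mul_pow, mul_div_right_comm (D ^ 2)] at hamgm
    exact hamgm.trans (add_le_add_left (mul_le_mul_of_nonneg_right hc (by positivity)) _)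
  have hslow' : D * (n ^ 2 / (σ ^ 2) ^ 2) ≤ D * (n ^ 2 / (σ ^ 2 * σ)) := by
    gcongr
    nlinarith [hσ1]
  have hR2 : 0 ≤ 1 / (4 * σ ^ 2) * R ^ 2 := by positivity
  calc Q * Q' + R * R'
      ≤ (1 / (4 * σ ^ 2) - c * σ) * (Q ^ 2 + R ^ 2) + D * (n ^ 2 / (σ ^ 2 * σ))
        + D ^ 2 / (σ ^ 2 * σ) * n ^ 2 + 2 * (n * (D * (n ^ 2 / σ ^ 2))) := by
        linarith [(by ring : n * (D * (n / (σ ^ 2) ^ 2 + n ^ 2 / σ ^ 2))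
          = D * (n ^ 2 / (σ ^ 2) ^ 2) + n * (D * (n ^ 2 / σ ^ 2)))]
    _ = _ := by rw [← hQR]; ring

theorem le_mul_exp_sub_of_deriv_le {f f' G c : ℝ → ℝ} {S : ℝ}
    (hf : ∀ s, S ≤ s → HasDerivAt f (f' s) s) (hG : ∀ s, S ≤ s → HasDerivAt G (c s) s)
    (hle : ∀ s, S ≤ s → f' s ≤ c s * f s) {s : ℝ} (hs : S ≤ s) :
    f s ≤ f S * Real.exp (G s - G S) := by
  have hderiv : ∀ x, S ≤ x → HasDerivAt (fun x => f x * Real.exp (-G x))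
      (f' x * Real.exp (-G x) + f x * (Real.exp (-G x) * -c x)) x :=
    fun x hx => (hf x hx).mul (hG x hx).neg.exp
  have hanti : AntitoneOn (fun x => f x * Real.exp (-G x)) (Set.Ici S) := by
    refine antitoneOn_of_hasDerivWithinAt_nonpos (convex_Ici S)
      (fun x hx => (hderiv x hx).continuousAt.continuousWithinAt)
      (fun x hx => (hderiv x (interior_subset hx)).hasDerivWithinAt) fun x hx => ?_
    have := mul_le_mul_of_nonneg_right (hle x (interior_subset hx)) (Real.exp_pos (-G x)).le
    linarith
  have h : f s * Real.exp (-G s) ≤ f S * Real.exp (-G S) := hanti Set.self_mem_Ici hs hs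
  rwa [Real.exp_neg, Real.exp_neg, ← div_eq_mul_inv, ← div_eq_mul_inv,
    div_le_iff₀ (Real.exp_pos _), div_mul_eq_mul_div, mul_div_assoc, ← Real.exp_sub] at h

section EnergyInequality

variable {E E' : ℝ → ℝ} {c D S : ℝ}

theorem le_div_of_energy_inequality (hc : 1 / 4 ≤ c) (hS : 100 ≤ S) (hD : 0 ≤ D) (hDS : D ≤ S)
    (hE : ∀ s, S ≤ s → HasDerivAt E (E' s) s)
    (hE' : ∀ s, S ≤ s → E s ≤ 1 →
      E' s ≤ (1 / (2 * s) - 2 * c * √s + D / (s * √s) + D * √(E s) / s) * E s)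
    (hES : E S ≤ 1) {s : ℝ} (hs : S ≤ s) : E s ≤ S / s := by
  have hS0 : 0 < S := by linarith
  refine le_of_hasDerivAt_lt_of_eq hE
    (fun s hs => (hasDerivAt_inv (by linarith : s ≠ 0)).const_mul S)
    (by rwa [mul_inv_cancel₀ hS0.ne']) (fun s hs hEs => ?_) hs
  have hs0 : 0 < s := hS0.trans_le hs
  have hσ : 10 ≤ √s := Real.le_sqrt_of_sq_le (by linarith)
  have hE0 : 0 < E s := by rw [hEs]; positivity
  have hE1 : E s ≤ 1 := by rwa [hEs, ← div_eq_mul_inv, div_le_one hs0]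
  have hlog : 1 / (2 * s) ≤ 1 := (div_le_one (by positivity)).2 (by linarith)
  have hforcing : D / (s * √s) ≤ 1 := (div_le_one (by positivity)).2 (by nlinarith)
  have hroot : D * √(E s) / s ≤ 1 := (div_le_one hs0).2 <|
    (mul_le_of_le_one_right hD (Real.sqrt_le_one.2 hE1)).trans (hDS.trans hs)
  have hrate : 1 / (2 * s) - 2 * c * √s + D / (s * √s) + D * √(E s) / s < -(1 / s) := by
    have : 1 / s ≤ 1 := (div_le_one hs0).2 (by linarith)
    nlinarith
  calc E' s ≤ _ := hE' s hs hE1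
    _ < -(1 / s) * E s := mul_lt_mul_of_pos_right hrate hE0
    _ = S * -(s ^ 2)⁻¹ := by rw [hEs]; ring

theorem hasDerivAt_log_sub_rpow_sub_inv_sqrt (c B : ℝ) {s : ℝ} (hs : 0 < s) :
    HasDerivAt (fun s => Real.log s / 2 - 4 / 3 * c * s ^ (3 / 2 : ℝ) - 2 * B * (√s)⁻¹)
      (1 / (2 * s) - 2 * c * √s + B / (s * √s)) s := by
  have hσ : 0 < √s := Real.sqrt_pos.2 hs
  refine ((((Real.hasDerivAt_log hs.ne').div_const 2).sub
    ((hasDerivAt_rpow_three_halves hs).const_mul (4 / 3 * c))).sub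
    (((Real.hasDerivAt_sqrt hs.ne').inv hσ.ne').const_mul (2 * B))).congr_deriv ?_
  rw [Real.sq_sqrt hs.le]
  field_simp
  ring

theorem exists_le_of_energy_inequality (hc : 1 / 4 ≤ c) (hS : 100 ≤ S) (hD : 0 ≤ D) (hDS : D ≤ S)
    (hE₀ : ∀ s, S ≤ s → 0 ≤ E s) (hE : ∀ s, S ≤ s → HasDerivAt E (E' s) s)
    (hE' : ∀ s, S ≤ s → E s ≤ 1 →
      E' s ≤ (1 / (2 * s) - 2 * c * √s + D / (s * √s) + D * √(E s) / s) * E s)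
    (hES : E S ≤ 1) :
    ∃ C, ∀ s, S ≤ s → E s ≤ C * (√s * Real.exp (-(4 / 3 * c) * s ^ (3 / 2 : ℝ))) := by
  set B := D + D * √S with hB
  set G : ℝ → ℝ := fun s => Real.log s / 2 - 4 / 3 * c * s ^ (3 / 2 : ℝ) - 2 * B * (√s)⁻¹ with hG
  have hS0 : 0 < S := by linarith
  have hGd : ∀ s, S ≤ s → HasDerivAt G (1 / (2 * s) - 2 * c * √s + B / (s * √s)) s :=
    fun s hs => hasDerivAt_log_sub_rpow_sub_inv_sqrt c B (hS0.trans_le hs)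
  have hle : ∀ s, S ≤ s → E' s ≤ (1 / (2 * s) - 2 * c * √s + B / (s * √s)) * E s := by
    intro s hs
    have hs0 : 0 < s := hS0.trans_le hs
    have hEs : E s ≤ S / s := le_div_of_energy_inequality hc hS hD hDS hE hE' hES hs
    have hroot : D * √(E s) / s ≤ D * (√S / √s) / s := by
      rw [← Real.sqrt_div hS0.le]
      gcongr
    refine (hE' s hs (hEs.trans ((div_le_one hs0).2 hs))).trans
      (mul_le_mul_of_nonneg_right ?_ (hE₀ s hs))
    have hsplit : B / (s * √s) = D / (s * √s) + D * (√S / √s) / s := by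
      rw [hB]
      ring
    linarith
  refine ⟨E S * Real.exp (-G S), fun s hs => ?_⟩
  have hs0 : 0 < s := hS0.trans_le hs
  have hGs : Real.exp (G s) ≤ √s * Real.exp (-(4 / 3 * c) * s ^ (3 / 2 : ℝ)) := by
    rw [← Real.exp_log (Real.sqrt_pos.2 hs0), Real.log_sqrt hs0.le, ← Real.exp_add]
    have : 0 ≤ 2 * B * (√s)⁻¹ := by positivity
    exact Real.exp_le_exp.2 (by simp only [hG]; linarith)
  calc E s ≤ E S * Real.exp (G s - G S) := le_mul_exp_sub_of_deriv_le hE hGd hle hs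
    _ = E S * Real.exp (-G S) * Real.exp (G s) := by
        rw [mul_assoc, ← Real.exp_add, neg_add_eq_sub]
    _ ≤ _ := mul_le_mul_of_nonneg_left hGs (mul_nonneg (hE₀ S le_rfl) (Real.exp_pos _).le)

end EnergyInequality

/-- The quadratic energy, at `t = -s`, of the displacement `z` from a solution of the `q₂`-`α`
system. To leading order `s * z.2 + z.1 / 4` diagonalizes the linear part together with `z.1`. -/
noncomputable def incrementEnergy (s : ℝ) (z : ℝ × ℝ) : ℝ :=
  z.1 ^ 2 + (s * z.2 + z.1 / 4) ^ 2

section Energy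

variable {s : ℝ} {z : ℝ × ℝ}

theorem incrementEnergy_nonneg (s : ℝ) (z : ℝ × ℝ) : 0 ≤ incrementEnergy s z :=
  add_nonneg (sq_nonneg _) (sq_nonneg _)

theorem abs_fst_le_sqrt_incrementEnergy (s : ℝ) (z : ℝ × ℝ) : |z.1| ≤ √(incrementEnergy s z) :=
  Real.abs_le_sqrt (le_add_of_nonneg_right (sq_nonneg _))

theorem abs_mul_add_le_sqrt_incrementEnergy (s : ℝ) (z : ℝ × ℝ) :
    |s * z.2 + z.1 / 4| ≤ √(incrementEnergy s z) :=
  Real.abs_le_sqrt (le_add_of_nonneg_left (sq_nonneg _))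

theorem abs_snd_le_sqrt_incrementEnergy_div (hs : 0 < s) (z : ℝ × ℝ) :
    |z.2| ≤ 2 * √(incrementEnergy s z) / s :=
  abs_snd_le hs (abs_fst_le_sqrt_incrementEnergy s z) (abs_mul_add_le_sqrt_incrementEnergy s z)

theorem norm_le_one_of_incrementEnergy_le_one (hs : 2 ≤ s) (hE : incrementEnergy s z ≤ 1) :
    ‖z‖ ≤ 1 := by
  have hroot : √(incrementEnergy s z) ≤ 1 := Real.sqrt_le_one.2 hE
  refine max_le ((abs_fst_le_sqrt_incrementEnergy s z).trans hroot)
    ((abs_snd_le_sqrt_incrementEnergy_div (two_pos.trans_le hs) z).trans ?_)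
  exact (div_le_one (two_pos.trans_le hs)).2 (by linarith)

theorem incrementEnergy_le_one (hs : 1 ≤ s) (hz : ‖z‖ ≤ 1 / (2 * s)) :
    incrementEnergy s z ≤ 1 := by
  have hQ : |z.1| ≤ 1 / 2 :=
    (norm_fst_le z).trans (hz.trans (one_div_le_one_div_of_le two_pos (by linarith)))
  have hP : |s * z.2| ≤ 1 / 2 := by
    rw [abs_mul, abs_of_pos (by linarith : 0 < s)]
    calc s * |z.2| ≤ s * (1 / (2 * s)) :=
          mul_le_mul_of_nonneg_left ((norm_snd_le z).trans hz) (by linarith)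
      _ = 1 / 2 := by field_simp
  rw [abs_le] at hQ hP
  rw [incrementEnergy]
  nlinarith

theorem hasDerivAt_incrementEnergy {w : ℝ → ℝ × ℝ} {w' : ℝ × ℝ} (hw : HasDerivAt w w' s) :
    HasDerivAt (fun s => incrementEnergy s (w s))
      (2 * ((w s).1 * w'.1 + (s * (w s).2 + (w s).1 / 4) * ((w s).2 + s * w'.2 + w'.1 / 4))) s := by
  have hQ : HasDerivAt (fun s => (w s).1) w'.1 s := hw.fst
  have hP : HasDerivAt (fun s => (w s).2) w'.2 s := hw.snd
  refine ((hQ.pow 2).add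
    ((((hasDerivAt_id s).mul hP).add (hQ.div_const 4)).pow 2)).congr_deriv ?_
  simp only [id, Pi.add_apply, Pi.mul_apply]
  ring

theorem IsFarField.energy_inequality {M r k q α : ℝ} (h : IsFarField M s r k q α) (z : ℝ × ℝ) :
    2 * (z.1 * -(qAlphaIncrement r k q α z).1 + (s * z.2 + z.1 / 4)
        * (z.2 - s * (qAlphaIncrement r k q α z).2 - (qAlphaIncrement r k q α z).1 / 4))
      ≤ (1 / (2 * s) - 2 * (√2 / 3) * √s + 220 * M ^ 4 / (s * √s)
        + 220 * M ^ 4 * √(incrementEnergy s z) / s) * incrementEnergy s z := by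
  have hs := h.pos
  have hM := h.one_le
  have hE := Real.sq_sqrt (incrementEnergy_nonneg s z)
  have hQ := abs_fst_le_sqrt_incrementEnergy s z
  have hR := abs_mul_add_le_sqrt_incrementEnergy s z
  have hdiss := dissipation_le (c := √2 / 3)
    (by linarith [Real.one_le_sqrt.2 (one_le_two (α := ℝ))]) (by linarith [h.eight_le])
    (by positivity) (Real.sqrt_nonneg _) hE (h.abs_slow_sub_le hQ hR) (h.abs_fast_add_le hQ hR)
  rw [hE] at hdiss
  refine (mul_le_mul_of_nonneg_left hdiss two_pos.le).trans ?_
  rw [← mul_assoc]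
  refine mul_le_mul_of_nonneg_right ?_ (incrementEnergy_nonneg s z)
  have hM2 : M ^ 2 ≤ M ^ 4 := pow_le_pow_right₀ hM (by norm_num)
  have hσ : 2 * ((10 * M ^ 2 + (10 * M ^ 2) ^ 2) / (s * √s)) ≤ 220 * M ^ 4 / (s * √s) := by
    rw [← mul_div_assoc]
    refine div_le_div_of_nonneg_right ?_ (by positivity)
    linarith
  have hn : 2 * (2 * (10 * M ^ 2) * √(incrementEnergy s z) / s)
      ≤ 220 * M ^ 4 * √(incrementEnergy s z) / s := by
    rw [← mul_div_assoc, ← mul_assoc]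
    refine div_le_div_of_nonneg_right (mul_le_mul_of_nonneg_right ?_ (Real.sqrt_nonneg _)) hs.le
    linarith [(by positivity : 0 ≤ M ^ 4)]
  linarith [(by ring : 1 / (2 * s) = 2 * (1 / (4 * s)))]

end Energy

section Decay

variable {u q α : ℝ → ℝ} {z : ℝ → ℝ × ℝ} {M S t₀ : ℝ}

theorem exists_energy_inequality_of_isIntegralCurveOn_clip
    (hfar : ∀ s, S ≤ s →
      IsFarField M s (deriv u (-s) / u (-s)) (u (-s) ^ 2 + -s / 2) (q (-s)) (α (-s)))
    (hS : -S < t₀)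
    (hz : IsIntegralCurveOn z (fun t w => incrementField u q α t (clip w)) (Set.Iic t₀)) :
    ∃ E' : ℝ → ℝ, ∀ s, S ≤ s →
      HasDerivAt (fun s => incrementEnergy s (z (-s))) (E' s) s ∧
      (incrementEnergy s (z (-s)) ≤ 1 →
        E' s ≤ (1 / (2 * s) - 2 * (√2 / 3) * √s + 220 * M ^ 4 / (s * √s)
          + 220 * M ^ 4 * √(incrementEnergy s (z (-s))) / s) * incrementEnergy s (z (-s))) := by
  set F := fun s => incrementField u q α (-s) (clip (z (-s)))
  refine ⟨fun s => 2 * ((z (-s)).1 * -(F s).1 + (s * (z (-s)).2 + (z (-s)).1 / 4)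
    * ((z (-s)).2 - s * (F s).2 - (F s).1 / 4)), fun s hs => ⟨?_, fun hE => ?_⟩⟩
  · have hzs : HasDerivAt z (F s) (-s) :=
      (hz (-s) (by simp only [Set.mem_Iic]; linarith)).hasDerivAt (Iic_mem_nhds (by linarith))
    have hzneg : HasDerivAt (fun s => z (-s)) (-F s) s :=
      (hzs.scomp s (hasDerivAt_neg s)).congr_deriv (neg_one_smul ℝ _)
    refine (hasDerivAt_incrementEnergy hzneg).congr_deriv ?_
    simp only [Prod.fst_neg, Prod.snd_neg]
    ring
  · have hclip : clip (z (-s)) = z (-s) :=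
      clip_eq_self (norm_le_one_of_incrementEnergy_le_one (by linarith [(hfar s hs).eight_le]) hE)
    simp only [F, hclip]
    exact (hfar s hs).energy_inequality (z (-s))

theorem incrementEnergy_le_one_of_isIntegralCurveOn_clip
    (hfar : ∀ s, S ≤ s →
      IsFarField M s (deriv u (-s) / u (-s)) (u (-s) ^ 2 + -s / 2) (q (-s)) (α (-s)))
    (hS : -S < t₀) (hMS : 220 * M ^ 4 ≤ S)
    (hz : IsIntegralCurveOn z (fun t w => incrementField u q α t (clip w)) (Set.Iic t₀))
    (hzS : ‖z (-S)‖ ≤ 1 / (2 * S)) {s : ℝ} (hs : S ≤ s) : incrementEnergy s (z (-s)) ≤ 1 := by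
  obtain ⟨E', hE'⟩ := exists_energy_inequality_of_isIntegralCurveOn_clip hfar hS hz
  have hM : 1 ≤ M ^ 4 := one_le_pow₀ (hfar S le_rfl).one_le
  refine (le_div_of_energy_inequality (by linarith [Real.one_le_sqrt.2 (one_le_two (α := ℝ))])
    (by linarith) (by positivity) hMS (fun s hs => (hE' s hs).1) (fun s hs => (hE' s hs).2)
    (incrementEnergy_le_one (by linarith) hzS) hs).trans ((div_le_one (by linarith)).2 hs)

theorem exists_incrementEnergy_le_of_isIntegralCurveOn_clip
    (hfar : ∀ s, S ≤ s →
      IsFarField M s (deriv u (-s) / u (-s)) (u (-s) ^ 2 + -s / 2) (q (-s)) (α (-s)))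
    (hS : -S < t₀) (hMS : 220 * M ^ 4 ≤ S)
    (hz : IsIntegralCurveOn z (fun t w => incrementField u q α t (clip w)) (Set.Iic t₀))
    (hzS : ‖z (-S)‖ ≤ 1 / (2 * S)) :
    ∃ C, ∀ s, S ≤ s → incrementEnergy s (z (-s))
      ≤ C * (√s * Real.exp (-(4 / 3 * (√2 / 3)) * s ^ (3 / 2 : ℝ))) := by
  obtain ⟨E', hE'⟩ := exists_energy_inequality_of_isIntegralCurveOn_clip hfar hS hz
  have hM : 1 ≤ M ^ 4 := one_le_pow₀ (hfar S le_rfl).one_le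
  exact exists_le_of_energy_inequality (by linarith [Real.one_le_sqrt.2 (one_le_two (α := ℝ))])
    (by linarith) (by positivity) hMS (fun _ _ => incrementEnergy_nonneg _ _)
    (fun s hs => (hE' s hs).1) (fun s hs => (hE' s hs).2)
    (incrementEnergy_le_one (by linarith) hzS)

theorem sqrt_sqrt_mul_exp {s : ℝ} (hs : 0 ≤ s) (x : ℝ) :
    √(√s * Real.exp x) = s ^ (1 / 4 : ℝ) * Real.exp (x / 2) := by
  rw [Real.sqrt_mul (Real.sqrt_nonneg s), Real.exp_half, Real.sqrt_eq_rpow, Real.sqrt_eq_rpow,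
    ← Real.rpow_mul hs]
  norm_num

theorem isBigO_of_incrementEnergy_le {C c : ℝ}
    (hE : ∀ s, S ≤ s →
      incrementEnergy s (z (-s)) ≤ C * (√s * Real.exp (-(2 * c) * s ^ (3 / 2 : ℝ)))) :
    ((fun t => (z t).1) =O[atBot] fun t =>
      (-t) ^ (1 / 4 : ℝ) * Real.exp (-c * (-t) ^ (3 / 2 : ℝ))) ∧
    (fun t => (z t).2) =O[atBot] fun t =>
      (-t) ^ (-(3 / 4) : ℝ) * Real.exp (-c * (-t) ^ (3 / 2 : ℝ)) := by
  have hroot : ∀ t < 0, t ≤ -S → √(incrementEnergy (-t) (z t))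
      ≤ √C * ((-t) ^ (1 / 4 : ℝ) * Real.exp (-c * (-t) ^ (3 / 2 : ℝ))) := by
    intro t ht htS
    have h := Real.sqrt_le_sqrt (hE (-t) (by linarith))
    rw [neg_neg, Real.sqrt_mul' _ (by positivity), sqrt_sqrt_mul_exp (by linarith)] at h
    convert h using 4
    ring
  constructor
  · refine IsBigO.of_bound √C ?_
    filter_upwards [eventually_lt_atBot 0, eventually_le_atBot (-S)] with t ht htS
    have hpos : 0 < -t := neg_pos.2 ht
    rw [Real.norm_eq_abs, Real.norm_of_nonneg (by positivity)]
    exact (abs_fst_le_sqrt_incrementEnergy (-t) (z t)).trans (hroot t ht htS)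
  · refine IsBigO.of_bound (2 * √C) ?_
    filter_upwards [eventually_lt_atBot 0, eventually_le_atBot (-S)] with t ht htS
    have hpos : 0 < -t := neg_pos.2 ht
    have hpow : (-t) ^ (-(3 / 4) : ℝ) = (-t) ^ (1 / 4 : ℝ) / -t := by
      rw [← Real.rpow_sub_one hpos.ne']
      norm_num
    rw [Real.norm_eq_abs, Real.norm_of_nonneg (by positivity), hpow]
    calc |(z t).2| ≤ 2 * √(incrementEnergy (-t) (z t)) / -t :=
          abs_snd_le_sqrt_incrementEnergy_div hpos (z t)
      _ ≤ 2 * (√C * ((-t) ^ (1 / 4 : ℝ) * Real.exp (-c * (-t) ^ (3 / 2 : ℝ)))) / -t := by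
          gcongr
          exact hroot t ht htS
      _ = _ := by ring

end Decay

theorem exists_eventually_isFarField {u q α : ℝ → ℝ} (hu : IsHastingsMcLeod u)
    (hq : q =O[atBot] fun t => t⁻¹)
    (hα : (fun t => α t - (1 / √2 * √(-t) + 1 / (8 * t))) =O[atBot] fun t => (t ^ 2)⁻¹) :
    ∃ M, ∀ᶠ s in atTop,
      IsFarField M s (deriv u (-s) / u (-s)) (u (-s) ^ 2 + -s / 2) (q (-s)) (α (-s)) := by
  have hq' := hq.comp_tendsto tendsto_neg_atTop_atBot
  have hα' := hα.comp_tendsto tendsto_neg_atTop_atBot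
  obtain ⟨M, hM, hMr, hMk, hMq, hMα⟩ := ((eventually_ge_atTop 1).and <|
    (isBigO_iff_eventually.1 hu.isBigO_logDeriv_add).and <|
    (isBigO_iff_eventually.1 hu.isBigO_sq_sub).and <|
    (isBigO_iff_eventually.1 hq').and (isBigO_iff_eventually.1 hα')).exists
  refine ⟨M, ?_⟩
  filter_upwards [eventually_gt_atTop 0, eventually_ge_atTop (8 * M ^ 2), hMr, hMk, hMq, hMα]
    with s hs hMs hr hk hq hα
  have hsq : M * ‖s ^ (-2 : ℝ)‖ = M / s ^ 2 := by
    rw [Real.norm_of_nonneg (by positivity), Real.rpow_neg hs.le, Real.rpow_two, div_eq_mul_inv]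
  simp only [Function.comp, Real.norm_eq_abs, neg_neg, abs_inv, abs_neg, abs_sq,
    abs_of_pos hs, even_two.neg_pow, ← Real.sqrt_div_self'] at hq hα
  refine ⟨hM, hMs, hr.trans_eq hsq, ?_, ?_, ?_⟩
  · refine Eq.trans_le ?_ (hk.trans_eq hsq)
    rw [Real.norm_eq_abs, neg_div, ← sub_eq_add_neg]
  · rwa [div_eq_mul_inv]
  · rw [div_eq_mul_inv]
    refine Eq.trans_le ?_ hα
    congr 1
    ring

theorem HasExpansionAtBot.of_sub_isBigO_exp {f g : ℝ → ℝ} {ρ : ℝ} {c : ℕ → ℝ}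
    (hf : HasExpansionAtBot f ρ c) {e b : ℝ} (he : 0 < e)
    (hfg : (fun t => g t - f t) =O[atBot] fun t =>
      (-t) ^ b * Real.exp (-e * (-t) ^ (3 / 2 : ℝ))) :
    HasExpansionAtBot g ρ c := by
  intro N
  have hexp : (fun t : ℝ => (-t) ^ b * Real.exp (-e * (-t) ^ (3 / 2 : ℝ))) =O[atBot]
      fun t : ℝ => (-t) ^ (ρ - 3 * (N : ℝ) / 2) := by
    refine (((isBigO_refl (fun s : ℝ => s ^ b) atTop).mul
      (isLittleO_exp_neg_mul_rpow_three_halves he (ρ - 3 * (N : ℝ) / 2 - b)).isBigO).comp_tendsto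
        tendsto_neg_atBot_atTop).trans_eventuallyEq ?_
    filter_upwards [eventually_lt_atBot 0] with t ht
    rw [Function.comp, ← Real.rpow_add (neg_pos.2 ht), add_sub_cancel]
  exact ((hf N).add (hfg.trans hexp)).congr_left fun t => by ring

namespace HasQAlphaAsymptotics

variable {a b : ℕ → ℝ} {q α p β : ℝ → ℝ}

theorem isBigO_q (h : HasQAlphaAsymptotics a b q α) : q =O[atBot] fun t => t⁻¹ := by
  have hpow : (fun t : ℝ => (-t) ^ (-(3 / 2) : ℝ)) =O[atBot] fun t => (-t) ^ (-1 : ℝ) :=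
    (isBigO_rpow_rpow_of_le (by norm_num)).comp_tendsto tendsto_neg_atBot_atTop
  simpa [Real.rpow_neg_one] using
    (by simpa using h.expansion_q 0 : q =O[atBot] fun t => (-t) ^ (-(3 / 2) : ℝ)).trans hpow

theorem isBigO_α (h : HasQAlphaAsymptotics a b q α) :
    (fun t => α t - (1 / √2 * √(-t) + 1 / (8 * t))) =O[atBot] fun t => (t ^ 2)⁻¹ := by
  have hpow : (fun t : ℝ => (-t) ^ (1 / 2 - 3 * (2 : ℕ) / 2 : ℝ)) =O[atBot]
      fun t => (-t) ^ (-2 : ℝ) :=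
    (isBigO_rpow_rpow_of_le (by norm_num)).comp_tendsto tendsto_neg_atBot_atTop
  refine ((h.expansion_α 2).trans hpow).congr' ?_ ?_
  · filter_upwards with t
    have hpow₀ : (-t) ^ (1 / 2 - 3 * ((0 : ℕ) : ℝ) / 2) = √(-t) := by
      rw [Nat.cast_zero, mul_zero, zero_div, sub_zero, Real.sqrt_eq_rpow]
    have hpow₁ : (-t) ^ (1 / 2 - 3 * ((1 : ℕ) : ℝ) / 2) = -t⁻¹ := by
      rw [← inv_neg, ← Real.rpow_neg_one]
      norm_num
    rw [Finset.sum_range_succ, Finset.sum_range_one, h.b_zero, h.b_one, hpow₀, hpow₁]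
    ring
  · filter_upwards [eventually_lt_atBot 0] with t ht
    rw [Real.rpow_neg (neg_pos.2 ht).le, Real.rpow_two, neg_sq]

theorem of_sub_isBigO_exp (h : HasQAlphaAsymptotics a b q α) {e c d : ℝ} (he : 0 < e)
    (hp : (fun t => p t - q t) =O[atBot] fun t =>
      (-t) ^ c * Real.exp (-e * (-t) ^ (3 / 2 : ℝ)))
    (hβ : (fun t => β t - α t) =O[atBot] fun t =>
      (-t) ^ d * Real.exp (-e * (-t) ^ (3 / 2 : ℝ))) :
    HasQAlphaAsymptotics a b p β :=
  { h with
    expansion_q := h.expansion_q.of_sub_isBigO_exp he hp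
    expansion_α := h.expansion_α.of_sub_isBigO_exp he hβ }

end HasQAlphaAsymptotics

theorem exists_isIntegralCurveOn_incrementField {u q α : ℝ → ℝ} {t₀ t₁ : ℝ}
    (hu : IsHastingsMcLeod u) (hsol : IsQAlphaSolutionOn u q α (Set.Iic t₀)) (ht₁ : t₁ ≤ t₀)
    (hq : q =O[atBot] fun t => t⁻¹)
    (hα : (fun t => α t - (1 / √2 * √(-t) + 1 / (8 * t))) =O[atBot] fun t => (t ^ 2)⁻¹) :
    ∃ δ : ℝ, 0 < δ ∧ ∀ z₁ : ℝ × ℝ, ‖z₁‖ < δ → ∃ z : ℝ → ℝ × ℝ, z t₁ = z₁ ∧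
      IsIntegralCurveOn z (incrementField u q α) (Set.Iic t₀) ∧
      ((fun t => (z t).1) =O[atBot] fun t =>
        (-t) ^ (1 / 4 : ℝ) * Real.exp (-(2 * √2 / 9) * (-t) ^ (3 / 2 : ℝ))) ∧
      (fun t => (z t).2) =O[atBot] fun t =>
        (-t) ^ (-(3 / 4) : ℝ) * Real.exp (-(2 * √2 / 9) * (-t) ^ (3 / 2 : ℝ)) := by
  obtain ⟨M, hM⟩ := exists_eventually_isFarField hu hq hα
  obtain ⟨S, hSall⟩ := (hM.and <| (eventually_ge_atTop (220 * M ^ 4)).and <|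
    (eventually_ge_atTop (-t₁)).and (eventually_gt_atTop (-t₀))).exists_forall_of_atTop
  have hfar := fun s hs => (hSall s hs).1
  obtain ⟨-, hMS, hSt₁, hSt₀⟩ := hSall S le_rfl
  have hS8 : 8 ≤ S := (hfar S le_rfl).eight_le
  have hS₀ : -S < t₀ := neg_lt.1 hSt₀
  obtain ⟨K, hK, hgrowth⟩ := exists_norm_le_mul_of_isIntegralCurveOn_clip hu hsol
    (T := -S) ⟨neg_le.1 hSt₁, ht₁⟩
  refine ⟨1 / (2 * S) / K, by positivity, fun z₁ hz₁ => ?_⟩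
  obtain ⟨z, hzt₁, hz⟩ := exists_isIntegralCurveOn_clip hu hsol ht₁ z₁
  have hnear : ∀ t ∈ Set.Icc (-S) t₀, ‖z t‖ ≤ 1 / (2 * S) := fun t ht =>
    (hgrowth z hz t ht).trans (by rw [hzt₁, mul_comm]; exact ((lt_div_iff₀ hK).1 hz₁).le)
  have hzS : ‖z (-S)‖ ≤ 1 / (2 * S) := hnear (-S) ⟨le_rfl, hS₀.le⟩
  have hle : ∀ t ≤ t₀, ‖z t‖ ≤ 1 := by
    intro t ht
    rcases le_total (-S) t with htS | htS
    · exact (hnear t ⟨htS, ht⟩).trans ((div_le_one (by linarith)).2 (by linarith))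
    · have hE := incrementEnergy_le_one_of_isIntegralCurveOn_clip hfar hS₀ hMS hz hzS
        (le_neg_of_le_neg htS)
      rw [neg_neg] at hE
      exact norm_le_one_of_incrementEnergy_le_one (by linarith) hE
  obtain ⟨C, hC⟩ := exists_incrementEnergy_le_of_isIntegralCurveOn_clip hfar hS₀ hMS hz hzS
  refine ⟨z, hzt₁, fun t ht => ?_, isBigO_of_incrementEnergy_le (C := C) (S := S) fun s hs => ?_⟩
  · simpa only [clip_eq_self (hle t ht)] using hz t ht
  · convert hC s hs using 5
    ring

theorem mainTheorem3_general (u : ℝ → ℝ) (hu : IsHastingsMcLeod u)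
    (t₀ : ℝ) (q₀ α₀ : ℝ → ℝ) (hsol : IsQAlphaSolutionOn u q₀ α₀ (Set.Iic t₀))
    (hq : q₀ =O[atBot] fun t => t⁻¹)
    (hα : (fun t => α₀ t - (1 / √2 * √(-t) + 1 / (8 * t))) =O[atBot] fun t => (t ^ 2)⁻¹)
    (t₁ : ℝ) (ht₁ : t₁ ≤ t₀) :
    ∃ δ : ℝ, 0 < δ ∧ ∀ x y : ℝ, |x - q₀ t₁| < δ → |y - α₀ t₁| < δ →
      ∃ q α : ℝ → ℝ, q t₁ = x ∧ α t₁ = y ∧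
        IsQAlphaSolutionOn u q α (Set.Iic t₀) ∧
        ((fun t : ℝ => q t - q₀ t) =O[atBot] fun t : ℝ =>
          (-t) ^ (1 / 4 : ℝ) * Real.exp (-(2 * √2 / 9) * (-t) ^ (3 / 2 : ℝ))) ∧
        ((fun t : ℝ => α t - α₀ t) =O[atBot] fun t : ℝ =>
          (-t) ^ (-(3 / 4) : ℝ) * Real.exp (-(2 * √2 / 9) * (-t) ^ (3 / 2 : ℝ))) ∧
        ∀ (J : Set ℝ) (p β : ℝ → ℝ), J.OrdConnected → t₁ ∈ J → J ⊆ Set.Iic t₀ →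
          IsQAlphaSolutionOn u p β J → p t₁ = x → β t₁ = y →
          Set.EqOn p q J ∧ Set.EqOn β α J := by
  obtain ⟨δ, hδ, hnearby⟩ := exists_isIntegralCurveOn_incrementField hu hsol ht₁ hq hα
  refine ⟨δ, hδ, fun x y hx hy => ?_⟩
  obtain ⟨z, hzt₁, hz, hzq, hzα⟩ := hnearby (x - q₀ t₁, y - α₀ t₁) (max_lt hx hy)
  have hqα := hsol.add_isIntegralCurveOn hz
  have hqt₁ : q₀ t₁ + (z t₁).1 = x := by rw [hzt₁, add_sub_cancel]
  have hαt₁ : α₀ t₁ + (z t₁).2 = y := by rw [hzt₁, add_sub_cancel]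
  refine ⟨_, _, hqt₁, hαt₁, hqα, ?_, ?_, fun J p β hJ ht₁J hJt₀ hpβ hp hβ => ?_⟩
  · simpa only [add_sub_cancel_left] using hzq
  · simpa only [add_sub_cancel_left] using hzα
  · exact (hqα.mono hJt₀).eqOn hu hJ ht₁J hpβ (hp.trans hqt₁.symm) (hβ.trans hαt₁.symm)

theorem mainTheorem3 (u : ℝ → ℝ) (hu : IsHastingsMcLeod u)
    (t₀ : ℝ) (q₀ α₀ : ℝ → ℝ) (hsol : IsQAlphaSolutionOn u q₀ α₀ (Set.Iic t₀))
    (a b : ℕ → ℝ) (hasym : HasQAlphaAsymptotics a b q₀ α₀)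
    (t₁ : ℝ) (ht₁ : t₁ ≤ t₀) :
    ∃ δ : ℝ, 0 < δ ∧ ∀ x y : ℝ, |x - q₀ t₁| < δ → |y - α₀ t₁| < δ →
      ∃ q α : ℝ → ℝ, q t₁ = x ∧ α t₁ = y ∧
        IsQAlphaSolutionOn u q α (Set.Iic t₀) ∧
        HasQAlphaAsymptotics a b q α ∧
        ((fun t : ℝ => q t - q₀ t) =O[atBot] fun t : ℝ =>
          (-t) ^ (1 / 4 : ℝ) * Real.exp (-(2 * √2 / 9) * (-t) ^ (3 / 2 : ℝ))) ∧
        ((fun t : ℝ => α t - α₀ t) =O[atBot] fun t : ℝ =>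
          (-t) ^ (-(3 / 4) : ℝ) * Real.exp (-(2 * √2 / 9) * (-t) ^ (3 / 2 : ℝ))) ∧
        ∀ (J : Set ℝ) (p β : ℝ → ℝ), J.OrdConnected → t₁ ∈ J → J ⊆ Set.Iic t₀ →
          IsQAlphaSolutionOn u p β J → p t₁ = x → β t₁ = y →
          Set.EqOn p q J ∧ Set.EqOn β α J := by
  obtain ⟨δ, hδ, h⟩ := mainTheorem3_general u hu t₀ q₀ α₀ hsol hasym.isBigO_q hasym.isBigO_α t₁ ht₁
  refine ⟨δ, hδ, fun x y hx hy => ?_⟩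
  obtain ⟨q, α, hq, hα, hqα, hqO, hαO, huniq⟩ := h x y hx hy
  exact ⟨q, α, hq, hα, hqα, hasym.of_sub_isBigO_exp (by positivity) hqO hαO, hqO, hαO, huniq⟩
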